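/- Consider the two-party game $g^{(1)}$ with inputs $x,y\in\{0,1\}$ drawn uniformly ($\pi_{AB}(x,y)=\frac14$), outputs $a,b\in\{0,1\}$, and winning predicate $V(a,b|x,y)=1$ exactly when $(x,y)=(0,0)$ and $(a,b)=(0,0)$; or $(x,y)=(1,0)$ and $a\oplus b=1$; or $(x,y)=(0,1)$ and $(a,b)=(1,0)$; or $(x,y)=(1,1)$ and $(a,b)=(0,1)$; otherwise $V(a,b|x,y)=0$. The value of a box $P$ is $\frac14\sum_{x,y,a,b}V(a,b|x,y)P(a,b|x,y)$. A quantum strategy consists of a density operator $\rho$ on a space $\mathbb C^m\otimes\mathbb C^n$ (any finite $m,n$) and POVMs $\{A^x_a\}_a$ on $\mathbb C^m$, $\{B^y_b\}_b$ on $\mathbb C^n$; its box is $P(a,b|x,y)=\operatorname{Tr}(\rho\,A^x_a\otimes B^y_b)$. It is optimal if no quantum strategy of any finite dimension has a larger value. For a strategy and a pair $(x,a)$, the uncertainty expression of a state $\sigma$ of Bob's system is $\sum_{y,b}\frac12V(a,b|x,y)\operatorname{Tr}(\sigma B^y_b)$; a state maximizing it over all states of Bob's system is called maximally certain for $(x,a)$;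 the uncertainty relation for $(x,a)$ is called trivial if in some state $\sigma$ Bob wins with certainty on every input that can be won, i.e. $\sum_b V(a,b|x,y)\operatorname{Tr}(\sigma B^y_b)=1$ for every $y$ for which some $b$ has $V(a,b|x,y)=1$. Alice steers Bob to the state $\sigma$ by $(x,a)$ if $p(a|x)=\operatorname{Tr}(\rho\,A^x_a\otimes\mathbf 1)>0$ and $\operatorname{Tr}_A[(A^x_a\otimes\mathbf 1)\rho]=p(a|x)\,\sigma$. The notions with the parties exchanged are defined in the same way, for pairs $(y,b)$ of Bob. The uncertainty principle--game value correspondence holds for a strategy, for Alice steering Bob, if for all $(x,a)$ with $p(a|x)>0$ she steers Bob by $(x,a)$ to a maximally certain state for $(x,a)$; similarly for Bob steering Alice. **Proposition.** 1. The classical (local hidden variable) value of $g^{(1)}$ is $\frac12$, and the quantum value is $\omega_q(g^{(1)})=\frac1{36}(16+\sqrt{13})\approx0.545$; both are attained. 2. Let $\alpha_0=\beta_0=0$, $\alpha_1=2\arctan\sqrt{\tfrac16(5+\sqrt{13})}$, $\beta_1=-\pi+\alpha_1$. On two qubits, let Alice and Bob measure the observables $M^x=\begin{pmatrix}0&e^{i\alpha_x}\\e^{-i\alpha_x}&0\end{pmatrix}$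 and $M^y=\begin{pmatrix}0&e^{i\beta_y}\\e^{-i\beta_y}&0\end{pmatrix}$, outputs $0,1$ corresponding to the eigenvalues $+1,-1$, with projectors $\Pi^x_a$, $\Pi^y_b$. The largest eigenvalue of the Bell operator $\frac14\sum_{x,y,a,b}V(a,b|x,y)\,\Pi^x_a\otimes\Pi^y_b$ has a unit eigenvector $|\psi\rangle$, unique up to phase, and the strategy given by $|\psi\rangle$ and these measurements is optimal, with value $\omega_q(g^{(1)})$. In this strategy the uncertainty relations of Bob's system for $(x,a)=(1,0)$ and of Alice's system for $(y,b)=(0,0)$ are not trivial. 3. (Self-testing.) The optimal strategy is unique up to local isometries: for every optimal quantum strategy $(\rho,A,B)$ there are isometries $W_A:\mathbb C^m\to\mathbb C^2\otimes\mathbb C^k$, $W_B:\mathbb C^n\to\mathbb C^2\otimes\mathbb C^l$ and a density operator $\sigma$ on $\mathbb C^k\otimes\mathbb C^l$ such that, with $W=W_A\otimes W_B$ and up to reordering tensor factors, $W\rho W^\dagger=|\psi\rangle\langle\psi|\otimes\sigma$ and $W(A^x_a\otimes B^y_b)\rho W^\dagger=(\Pi^x_a\otimes\Pi^y_b)|\psi\rangle\langle\psi|\otimes\sigma$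 for all $x,y,a,b$. 4. For every optimal quantum strategy: for each $(x,a)\in\{(0,0),(0,1),(1,1)\}$ the uncertainty relation of Bob's system is trivial, $p(a|x)>0$, and Alice does not steer Bob by $(x,a)$ to any maximally certain state for $(x,a)$; for each $(y,b)\in\{(0,1),(1,0),(1,1)\}$ the uncertainty relation of Alice's system is trivial, $p(b|y)>0$, and Bob does not steer Alice by $(y,b)$ to any maximally certain state for $(y,b)$. So the uncertainty principle--game value correspondence fails, for Alice steering Bob and for Bob steering Alice. -/

import Mathlib

open scoped Kronecker ComplexOrder

noncomputable section

namespace NonlocalGame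

/-! ### The game and its values -/

/-- A bipartite box `P(a,b|x,y)` with binary inputs and outputs, written `P a b x y`. -/
abbrev Box : Type := Fin 2 → Fin 2 → Fin 2 → Fin 2 → ℝ

/-- The winning predicate `V(a,b|x,y)` of the game. -/
def V : Box := fun a b x y =>
  if (x = 0 ∧ y = 0 ∧ a = 0 ∧ b = 0) ∨
     (x = 1 ∧ y = 0 ∧ a ≠ b) ∨
     (x = 0 ∧ y = 1 ∧ a = 1 ∧ b = 0) ∨
     (x = 1 ∧ y = 1 ∧ a = 0 ∧ b = 1) then 1 else 0

/-- The success probability of a box in the game with uniform inputs. -/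
def gameValue (P : Box) : ℝ :=
  ∑ x, ∑ y, (1 / 4 : ℝ) * ∑ a, ∑ b, V a b x y * P a b x y

/-- Local hidden variable boxes: `N` values of shared randomness with weights `p`, and local
response distributions `PA l x`, `PB l y`. -/
def IsClassicalBox (P : Box) : Prop :=
  ∃ (N : ℕ) (p : Fin N → ℝ) (PA PB : Fin N → Fin 2 → Fin 2 → ℝ),
    p ∈ stdSimplex ℝ (Fin N) ∧
    (∀ l x, PA l x ∈ stdSimplex ℝ (Fin 2)) ∧
    (∀ l y, PB l y ∈ stdSimplex ℝ (Fin 2)) ∧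
    ∀ a b x y, P a b x y = ∑ l, p l * (PA l x a * PB l y b)

/-! ### Quantum strategies -/

/-- Density matrices. -/
def IsDensity {ι : Type} [Fintype ι] (ρ : Matrix ι ι ℂ) : Prop :=
  ρ.PosSemidef ∧ ρ.trace = 1

/-- Two-outcome positive-operator valued measures. -/
def IsPOVM {ι : Type} [Fintype ι] [DecidableEq ι] (M : Fin 2 → Matrix ι ι ℂ) : Prop :=
  (∀ a, (M a).PosSemidef) ∧ ∑ a, M a = 1

/-- The data of a strategy on `ℂ^m ⊗ ℂ^n`: a bipartite operator `ρ` and operators `A x a`, `B y b`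
for Alice and Bob. The requirements on them are in `Strategy.IsQuantum`. -/
structure Strategy (m n : ℕ) where
  ρ : Matrix (Fin m × Fin n) (Fin m × Fin n) ℂ
  A : Fin 2 → Fin 2 → Matrix (Fin m) (Fin m) ℂ
  B : Fin 2 → Fin 2 → Matrix (Fin n) (Fin n) ℂ

namespace Strategy

variable {m n : ℕ}

/-- A quantum strategy: a (possibly mixed) state and POVMs. -/
structure IsQuantum (S : Strategy m n) : Prop where
  state : IsDensity S.ρ
  alice : ∀ x, IsPOVM (S.A x)
  bob : ∀ y, IsPOVM (S.B y)

/-- The box `P(a,b|x,y) = Tr (ρ (A^x_a ⊗ B^y_b))` of a strategy. -/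
def box (S : Strategy m n) : Box := fun a b x y =>
  (S.ρ * (S.A x a ⊗ₖ S.B y b)).trace.re

/-- The success probability of a strategy. -/
def value (S : Strategy m n) : ℝ := gameValue S.box

/-- Optimal quantum strategies, among the quantum strategies of all finite dimensions. -/
def IsOptimal (S : Strategy m n) : Prop :=
  S.IsQuantum ∧ ∀ (m' n' : ℕ) (T : Strategy m' n'), T.IsQuantum → T.value ≤ S.value

end Strategy

/-- Boxes that have a quantum realization in some finite dimension. -/
def IsQuantumBox (P : Box) : Prop :=
  ∃ (m n : ℕ) (S : Strategy m n), S.IsQuantum ∧ S.box = P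

/-- The number `(16 + √13) / 36`. -/
def omegaQ : ℝ := (16 + √13) / 36

/-! ### Local isometries -/

/-- `V` is an isometry. -/
def IsIsometry {ι κ : Type} [Fintype κ] [DecidableEq ι] (V : Matrix κ ι ℂ) : Prop :=
  V.conjTranspose * V = 1

/-- `S` coincides with the qubit strategy `R` up to local isometries and ancillas: there are
isometries `VA : ℂ^m → ℂ² ⊗ ℂ^k`, `VB : ℂ^n → ℂ² ⊗ ℂ^l` and an ancilla state `σ` on `ℂ^k ⊗ ℂ^l` which
carry the state and every product of local measurement operators acting on it to those of `R`,
tensored with `σ`. The `submatrix` reorders the tensor factors. -/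
def Strategy.EquivUpToLocalIsometry {m n : ℕ} (S : Strategy m n) (R : Strategy 2 2) : Prop :=
  ∃ (k l : ℕ) (VA : Matrix (Fin 2 × Fin k) (Fin m) ℂ) (VB : Matrix (Fin 2 × Fin l) (Fin n) ℂ)
    (σ : Matrix (Fin k × Fin l) (Fin k × Fin l) ℂ),
    IsIsometry VA ∧ IsIsometry VB ∧ IsDensity σ ∧
    (VA ⊗ₖ VB) * S.ρ * (VA ⊗ₖ VB).conjTranspose =
      (R.ρ ⊗ₖ σ).submatrix
        (Equiv.prodProdProdComm (Fin 2) (Fin k) (Fin 2) (Fin l))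
        (Equiv.prodProdProdComm (Fin 2) (Fin k) (Fin 2) (Fin l)) ∧
    ∀ x a y b,
      (VA ⊗ₖ VB) * ((S.A x a ⊗ₖ S.B y b) * S.ρ) * (VA ⊗ₖ VB).conjTranspose =
        (((R.A x a ⊗ₖ R.B y b) * R.ρ) ⊗ₖ σ).submatrix
          (Equiv.prodProdProdComm (Fin 2) (Fin k) (Fin 2) (Fin l))
          (Equiv.prodProdProdComm (Fin 2) (Fin k) (Fin 2) (Fin l))

/-! ### Uncertainty relations and steering -/

/-- Partial trace over the first factor. -/
def traceA {m n : ℕ} (X : Matrix (Fin m × Fin n) (Fin m × Fin n) ℂ) : Matrix (Fin n) (Fin n) ℂ :=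
  fun j j' => ∑ i, X (i, j) (i, j')

/-- Partial trace over the second factor. -/
def traceB {m n : ℕ} (X : Matrix (Fin m × Fin n) (Fin m × Fin n) ℂ) : Matrix (Fin m) (Fin m) ℂ :=
  fun i i' => ∑ j, X (i, j) (i', j)

namespace Strategy

variable {m n : ℕ}

/-- Bob's unnormalized conditional state after Alice's outcome `a` on input `x`. -/
def assemblageB (S : Strategy m n) (x a : Fin 2) : Matrix (Fin n) (Fin n) ℂ :=
  traceA ((S.A x a ⊗ₖ (1 : Matrix (Fin n) (Fin n) ℂ)) * S.ρ)

/-- Alice's unnormalized conditional state after Bob's outcome `b` on input `y`. -/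
def assemblageA (S : Strategy m n) (y b : Fin 2) : Matrix (Fin m) (Fin m) ℂ :=
  traceB (((1 : Matrix (Fin m) (Fin m) ℂ) ⊗ₖ S.B y b) * S.ρ)

/-- `P(a|x)`. -/
def probA (S : Strategy m n) (x a : Fin 2) : ℝ := (S.assemblageB x a).trace.re

/-- `P(b|y)`. -/
def probB (S : Strategy m n) (y b : Fin 2) : ℝ := (S.assemblageA y b).trace.re

/-- Given that Bob's system is in the state `σ` and that he is asked `y`, the probability that his
answer wins against Alice's pair `(x,a)`. -/
def winProbB (S : Strategy m n) (x a y : Fin 2) (σ : Matrix (Fin n) (Fin n) ℂ) : ℝ :=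
  ∑ b, V a b x y * (σ * S.B y b).trace.re

/-- Given that Alice's system is in the state `σ` and that she is asked `x`, the probability that
her answer wins against Bob's pair `(y,b)`. -/
def winProbA (S : Strategy m n) (y b x : Fin 2) (σ : Matrix (Fin m) (Fin m) ℂ) : ℝ :=
  ∑ a, V a b x y * (σ * S.A x a).trace.re

/-- The uncertainty expression of Bob's system for Alice's pair `(x,a)`. -/
def uncertaintyB (S : Strategy m n) (x a : Fin 2) (σ : Matrix (Fin n) (Fin n) ℂ) : ℝ :=
  ∑ y, (1 / 2 : ℝ) * S.winProbB x a y σ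

/-- The uncertainty expression of Alice's system for Bob's pair `(y,b)`. -/
def uncertaintyA (S : Strategy m n) (y b : Fin 2) (σ : Matrix (Fin m) (Fin m) ℂ) : ℝ :=
  ∑ x, (1 / 2 : ℝ) * S.winProbA y b x σ

/-- `σ` is a maximally certain state of Bob's system for `(x,a)`: it maximizes the uncertainty
expression over all states. -/
def IsMaxCertainB (S : Strategy m n) (x a : Fin 2) (σ : Matrix (Fin n) (Fin n) ℂ) : Prop :=
  IsDensity σ ∧ ∀ τ, IsDensity τ → S.uncertaintyB x a τ ≤ S.uncertaintyB x a σ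

/-- `σ` is a maximally certain state of Alice's system for `(y,b)`. -/
def IsMaxCertainA (S : Strategy m n) (y b : Fin 2) (σ : Matrix (Fin m) (Fin m) ℂ) : Prop :=
  IsDensity σ ∧ ∀ τ, IsDensity τ → S.uncertaintyA y b τ ≤ S.uncertaintyA y b σ

/-- The uncertainty relation of Bob's system for `(x,a)` is trivial: in some state, Bob wins with
certainty for each of his inputs `y` for which some answer wins. -/
def IsTrivialB (S : Strategy m n) (x a : Fin 2) : Prop :=
  ∃ σ, IsDensity σ ∧ ∀ y, (∃ b, V a b x y = 1) → S.winProbB x a y σ = 1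

/-- The uncertainty relation of Alice's system for `(y,b)` is trivial. -/
def IsTrivialA (S : Strategy m n) (y b : Fin 2) : Prop :=
  ∃ σ, IsDensity σ ∧ ∀ x, (∃ a, V a b x y = 1) → S.winProbA y b x σ = 1

/-- By input `x` and outcome `a` (of positive probability) Alice steers Bob's system to `σ`. -/
def AliceSteersTo (S : Strategy m n) (x a : Fin 2) (σ : Matrix (Fin n) (Fin n) ℂ) : Prop :=
  0 < S.probA x a ∧ S.assemblageB x a = (S.probA x a : ℂ) • σ

/-- By input `y` and outcome `b` (of positive probability) Bob steers Alice's system to `σ`. -/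
def BobSteersTo (S : Strategy m n) (y b : Fin 2) (σ : Matrix (Fin m) (Fin m) ℂ) : Prop :=
  0 < S.probB y b ∧ S.assemblageA y b = (S.probB y b : ℂ) • σ

/-- The correspondence between uncertainty principle and game value, for Alice steering Bob: for
all pairs `(x,a)` that occur, Alice steers Bob's system to a maximally certain state. -/
def CorrespondenceAliceSteersBob (S : Strategy m n) : Prop :=
  ∀ x a, 0 < S.probA x a → ∃ σ, S.IsMaxCertainB x a σ ∧ S.AliceSteersTo x a σ

/-- The correspondence for Bob steering Alice. -/
def CorrespondenceBobSteersAlice (S : Strategy m n) : Prop :=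
  ∀ y b, 0 < S.probB y b → ∃ σ, S.IsMaxCertainA y b σ ∧ S.BobSteersTo y b σ

end Strategy

/-! ### The explicit qubit strategy -/

/-- The observable with rows `(0, e^{iθ})` and `(e^{-iθ}, 0)`. -/
def observable (θ : ℝ) : Matrix (Fin 2) (Fin 2) ℂ :=
  !![0, Complex.exp (Complex.I * θ); Complex.exp (-(Complex.I * θ)), 0]

/-- The projector of `observable θ` for the eigenvalue `(-1)^a`. -/
def projector (θ : ℝ) (a : Fin 2) : Matrix (Fin 2) (Fin 2) ℂ :=
  (1 / 2 : ℂ) • (1 + (-1 : ℂ) ^ (a : ℕ) • observable θ)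

/-- Alice's angles. -/
def alpha : Fin 2 → ℝ := ![0, 2 * Real.arctan √((5 + √13) / 6)]

/-- Bob's angles. -/
def beta : Fin 2 → ℝ := ![0, -Real.pi + 2 * Real.arctan √((5 + √13) / 6)]

/-- The Bell operator of the game for the measurements with angles `alpha` and `beta`. -/
def bellOperator : Matrix (Fin 2 × Fin 2) (Fin 2 × Fin 2) ℂ :=
  ∑ x, ∑ y, (1 / 4 : ℂ) • ∑ a, ∑ b,
    (V a b x y : ℂ) • (projector (alpha x) a ⊗ₖ projector (beta y) b)

/-- `ψ` is a unit eigenvector of the Bell operator for its largest eigenvalue. -/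
def IsTopEigenvector (ψ : Fin 2 × Fin 2 → ℂ) : Prop :=
  star ψ ⬝ᵥ ψ = 1 ∧ ∃ r : ℝ, bellOperator.mulVec ψ = (r : ℂ) • ψ ∧
    ∀ (s : ℝ) (φ : Fin 2 × Fin 2 → ℂ), φ ≠ 0 → bellOperator.mulVec φ = (s : ℂ) • φ → s ≤ r

/-- The qubit strategy with state vector `ψ` and measurements with angles `alpha` and `beta`. -/
def qubitStrategy (ψ : Fin 2 × Fin 2 → ℂ) : Strategy 2 2 where
  ρ := Matrix.vecMulVec ψ (star ψ)
  A := fun x a => projector (alpha x) a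
  B := fun y b => projector (beta y) b

end NonlocalGame

end

/-! With ±1-valued observables a₀, a₁ for Alice and b₀, b₁ for Bob, the value of a strategy is (5 +
⟨bell⟩)/16 for a bilinear Bell polynomial. The substitution q0 = -b₁, q1 = b₀ makes this polynomial
symmetric under exchange of the parties, so every statement about Alice's side transfers to Bob's.

The upper bound is a sum-of-squares certificate: `bellMax` minus the Bell polynomial is a positive
combination of five squares of bilinear polynomials, simplified by p² = q² = 1
(`sum_weight_smul_reducedSq`). For general POVMs the observables are only contractions. The error of
the simplification is then itself a sum of nonnegative defect terms (`reducedSq_eq`), so the bound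
needs no dilation to projective measurements.

At the optimum every term of the certificate vanishes on ρ. The defect terms show that the
observables square to one on ρ, and the five polynomials annihilate ρ. Linear algebra turns this
into a fixed anticommutator of each party's observables (`OptimalRelations.anticomm`) and into
formulas that trade one party's observables for polynomials in the other's (`exists_transfer`). The
latter make the support of each marginal invariant under the observables. On this support two
involutions with scalar anticommutator are a pair of qubit observables tensored with the identity
(`LocalRelations.exists_isometry`). After the local isometries every slice of ρ at fixed ancilla
indices is an eigenvector of the 4×4 Bell matrix for `bellMax`. That eigenspace is a line
(`eq_smul_topVector`), which is self-testing.

Steering fails because all sixteen probabilities of the optimal box are strictly positive. If only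
one answer of the other party wins against a pair, a maximally certain state must give this answer
with certainty: such states exist because the observables square to one on ρ. Steering to one would
give probability zero to the losing answer, contradicting positivity. -/

noncomputable section

namespace NonlocalGame

/-! ### Sums of squares of bilinear polynomials -/

/-- Real coefficients of a polynomial in two pairs of commuting variables, of degree at most one in
each pair. -/
structure BilinearCoeff where
  o : ℝ
  a0 : ℝ
  a1 : ℝ
  b0 : ℝ
  b1 : ℝ
  c00 : ℝ
  c01 : ℝ
  c10 : ℝ
  c11 : ℝ

namespace BilinearCoeff

variable {R : Type*} [Ring R] [Algebra ℝ R]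

/-- Evaluation of the polynomial. -/
def eval (g : BilinearCoeff) (p0 p1 q0 q1 : R) : R :=
  g.o • (1 : R) + g.a0 • p0 + g.a1 • p1 + g.b0 • q0 + g.b1 • q1 +
    g.c00 • (p0 * q0) + g.c01 • (p0 * q1) + g.c10 • (p1 * q0) + g.c11 • (p1 * q1)

/-- The square of the polynomial, simplified as if every variable squared to one. -/
def reducedSq (g : BilinearCoeff) (p0 p1 q0 q1 : R) : R :=
  (g.o ^ 2 + g.a0 ^ 2 + g.a1 ^ 2 + g.b0 ^ 2 + g.b1 ^ 2 + g.c00 ^ 2 + g.c01 ^ 2 + g.c10 ^ 2 +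
      g.c11 ^ 2) • (1 : R) +
    (2 * (g.o * g.a0 + g.b0 * g.c00 + g.b1 * g.c01)) • p0 +
    (2 * (g.o * g.a1 + g.b0 * g.c10 + g.b1 * g.c11)) • p1 +
    (2 * (g.o * g.b0 + g.a0 * g.c00 + g.a1 * g.c10)) • q0 +
    (2 * (g.o * g.b1 + g.a0 * g.c01 + g.a1 * g.c11)) • q1 +
    (2 * (g.o * g.c00 + g.a0 * g.b0)) • (p0 * q0) +
    (2 * (g.o * g.c01 + g.a0 * g.b1)) • (p0 * q1) +
    (2 * (g.o * g.c10 + g.a1 * g.b0)) • (p1 * q0) +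
    (2 * (g.o * g.c11 + g.a1 * g.b1)) • (p1 * q1) +
    (g.a0 * g.a1 + g.c00 * g.c10 + g.c01 * g.c11) • (p0 * p1 + p1 * p0) +
    (g.b0 * g.b1 + g.c00 * g.c01 + g.c10 * g.c11) • (q0 * q1 + q1 * q0) +
    (g.a0 * g.c10 + g.a1 * g.c00) • ((p0 * p1 + p1 * p0) * q0) +
    (g.a0 * g.c11 + g.a1 * g.c01) • ((p0 * p1 + p1 * p0) * q1) +
    (g.b0 * g.c01 + g.b1 * g.c00) • (p0 * (q0 * q1 + q1 * q0)) +
    (g.b0 * g.c11 + g.b1 * g.c10) • (p1 * (q0 * q1 + q1 * q0)) +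
    (g.c00 * g.c11) • (p0 * q0 * (p1 * q1) + p1 * q1 * (p0 * q0)) +
    (g.c01 * g.c10) • (p0 * q1 * (p1 * q0) + p1 * q0 * (p0 * q1))

/-- The coefficient of `p0`, a polynomial in the second pair. -/
def coeffP0 (g : BilinearCoeff) (q0 q1 : R) : R := g.a0 • (1 : R) + g.c00 • q0 + g.c01 • q1

/-- The coefficient of `p1`, a polynomial in the second pair. -/
def coeffP1 (g : BilinearCoeff) (q0 q1 : R) : R := g.a1 • (1 : R) + g.c10 • q0 + g.c11 • q1

/-- The coefficient of `q0`, a polynomial in the first pair. -/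
def coeffQ0 (g : BilinearCoeff) (p0 p1 : R) : R := g.b0 • (1 : R) + g.c00 • p0 + g.c10 • p1

/-- The coefficient of `q1`, a polynomial in the first pair. -/
def coeffQ1 (g : BilinearCoeff) (p0 p1 : R) : R := g.b1 • (1 : R) + g.c01 • p0 + g.c11 • p1

/-- Replacing p² by 1 in the square costs the `coeffP` terms, and likewise for q² and the `coeffQ`
terms. A monomial p²q² is affected by both replacements, and the products of two defects are the
correction. -/
theorem reducedSq_eq (g : BilinearCoeff) {p0 p1 q0 q1 : R} (h00 : q0 * p0 = p0 * q0)
    (h01 : q1 * p0 = p0 * q1) (h10 : q0 * p1 = p1 * q0) (h11 : q1 * p1 = p1 * q1) :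
    g.reducedSq p0 p1 q0 q1 =
      g.eval p0 p1 q0 q1 * g.eval p0 p1 q0 q1 +
      g.coeffP0 q0 q1 * (1 - p0 * p0) * g.coeffP0 q0 q1 +
      g.coeffP1 q0 q1 * (1 - p1 * p1) * g.coeffP1 q0 q1 +
      g.coeffQ0 p0 p1 * (1 - q0 * q0) * g.coeffQ0 p0 p1 +
      g.coeffQ1 p0 p1 * (1 - q1 * q1) * g.coeffQ1 p0 p1 +
      g.c00 ^ 2 • ((1 - p0 * p0) * (1 - q0 * q0)) + g.c01 ^ 2 • ((1 - p0 * p0) * (1 - q1 * q1)) +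
      g.c10 ^ 2 • ((1 - p1 * p1) * (1 - q0 * q0)) +
      g.c11 ^ 2 • ((1 - p1 * p1) * (1 - q1 * q1)) := by
  have k00 : ∀ x, q0 * (p0 * x) = p0 * (q0 * x) := fun x => by rw [← mul_assoc, h00, mul_assoc]
  have k01 : ∀ x, q1 * (p0 * x) = p0 * (q1 * x) := fun x => by rw [← mul_assoc, h01, mul_assoc]
  have k10 : ∀ x, q0 * (p1 * x) = p1 * (q0 * x) := fun x => by rw [← mul_assoc, h10, mul_assoc]
  have k11 : ∀ x, q1 * (p1 * x) = p1 * (q1 * x) := fun x => by rw [← mul_assoc, h11, mul_assoc]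
  simp only [reducedSq, eval, coeffP0, coeffP1, coeffQ0, coeffQ1, mul_add, add_mul, mul_sub,
    sub_mul, smul_mul_assoc, mul_smul_comm, smul_add, smul_sub, smul_smul, mul_assoc, mul_one,
    one_mul, h00, h01, h10, h11, k00, k01, k10, k11]
  module

end BilinearCoeff

/-! ### The certificate -/

/-- The Bell polynomial in `p0 = a₀`, `p1 = a₁`, `q0 = -b₁`, `q1 = b₀`. -/
def bellPoly {R : Type*} [Ring R] [Algebra ℝ R] (p0 p1 q0 q1 : R) : R :=
  p1 + q1 + p0 * q0 + p0 * q1 + p1 * q0 - (2 : ℝ) • (p1 * q1)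

/-- The quantum maximum of the Bell polynomial. -/
def bellMax : ℝ := (19 + 4 * √13) / 9

/-- The five polynomials whose squares certify the quantum maximum. -/
def certificate : Fin 5 → BilinearCoeff :=
  ![⟨-(13 + √13) / 12, (1 + √13) / 24, -(1 + √13) / 8, (1 + √13) / 24, -(1 + √13) / 8,
      1, (1 + √13) / 8, (1 + √13) / 8, 0⟩,
    ⟨(2 + √13) / 6, (2 + √13) / 12, -(14 + 3 * √13) / 12, (2 + √13) / 12, -(14 + 3 * √13) / 12,
      0, (√13 - 4) / 12, (√13 - 4) / 12, 1⟩,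
    ⟨(4 * √13 - 26) / 9, (2 * √13 - 1) / 3, -(7 + 4 * √13) / 3, (2 * √13 - 1) / 3,
      -(7 + 4 * √13) / 3, 0, 1, 1, 0⟩,
    ⟨0, -1, -1 / 3, 1, 1 / 3, 0, 1, -1, 0⟩,
    ⟨0, (1 + √13) / 2, 1, -(1 + √13) / 2, -1, 0, 0, 0, 0⟩]

/-- The weights of the squares. -/
def weight : Fin 5 → ℝ :=
  ![(4 - √13) / 4, (√13 - 3) / 4, (31 - 7 * √13) / 1152, (√13 - 3) / 16, (√13 - 1) / 36]

/-- The value `cos α₁`. -/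
def cosAngle : ℝ := (2 - √13) / 9

theorem sq_sqrt_thirteen : √13 * √13 = (13 : ℝ) := Real.mul_self_sqrt (by norm_num)

theorem sqrt_thirteen_gt : (3.605 : ℝ) < √13 := by
  rw [Real.lt_sqrt (by norm_num)]; norm_num

theorem sqrt_thirteen_lt : √13 < (3.606 : ℝ) := by
  rw [Real.sqrt_lt' (by norm_num)]; norm_num

theorem weight_pos (k : Fin 5) : 0 < weight k := by
  have h1 := sqrt_thirteen_gt
  have h2 := sqrt_thirteen_lt
  fin_cases k <;> simp [weight] <;> linarith

section Algebra

variable {R : Type*} [Ring R] [Algebra ℝ R]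

/-- A formal identity in noncommuting variables: the scalars in front of each word are compared,
using only √13² = 13. The words of degree three and four cancel. -/
theorem sum_weight_smul_reducedSq (p0 p1 q0 q1 : R) :
    ∑ k, weight k • (certificate k).reducedSq p0 p1 q0 q1 =
      bellMax • (1 : R) - bellPoly p0 p1 q0 q1 := by
  have hr := sq_sqrt_thirteen
  simp only [Fin.sum_univ_five, weight, certificate, BilinearCoeff.reducedSq, bellPoly, bellMax,
    Matrix.cons_val]
  generalize √13 = r at hr
  match_scalars <;> grind

/-- The relations that hold on the state of an optimal strategy. -/
structure OptimalRelations (p0 p1 q0 q1 ρ : R) : Prop where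
  comm00 : q0 * p0 = p0 * q0
  comm01 : q1 * p0 = p0 * q1
  comm10 : q0 * p1 = p1 * q0
  comm11 : q1 * p1 = p1 * q1
  sqP0 : p0 * (p0 * ρ) = ρ
  sqP1 : p1 * (p1 * ρ) = ρ
  sqQ0 : q0 * (q0 * ρ) = ρ
  sqQ1 : q1 * (q1 * ρ) = ρ
  cert : ∀ k, (certificate k).eval p0 p1 q0 q1 * ρ = 0

namespace OptimalRelations

variable {p0 p1 q0 q1 ρ : R}

/-- The first three certificate polynomials are invariant under exchanging the pairs, the last two
change sign. -/
theorem symm (h : OptimalRelations p0 p1 q0 q1 ρ) : OptimalRelations q0 q1 p0 p1 ρ where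
  comm00 := h.comm00.symm
  comm01 := h.comm10.symm
  comm10 := h.comm01.symm
  comm11 := h.comm11.symm
  sqP0 := h.sqQ0
  sqP1 := h.sqQ1
  sqQ0 := h.sqP0
  sqQ1 := h.sqP1
  cert := by
    intro k
    have hk := h.cert k
    fin_cases k <;>
      simp only [certificate, BilinearCoeff.eval, Fin.zero_eta, Fin.mk_one, Fin.reduceFinMk,
        Matrix.cons_val, h.comm00, h.comm01, h.comm10, h.comm11] at hk ⊢
    iterate 3
      · rw [← hk]; congr 1; module
    iterate 2
      · rw [← neg_eq_zero, ← hk, ← neg_mul]; congr 1; module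

/-- Subtracting multiples of the third polynomial from the first and second isolates p0 q0 and p1
q1; the third gives p0 q1 + p1 q0. The combination with the Bell coefficients 1, -2, 1 leaves only
the constant. -/
theorem bellPoly_mul (h : OptimalRelations p0 p1 q0 q1 ρ) :
    bellPoly p0 p1 q0 q1 * ρ = bellMax • ρ := by
  have hr := sq_sqrt_thirteen
  have h0 := h.cert 0
  have h1 := h.cert 1
  have h2 := h.cert 2
  simp only [certificate, BilinearCoeff.eval, Matrix.cons_val, add_mul, smul_mul_assoc, one_mul,
    mul_assoc] at h0 h1 h2
  simp only [bellPoly, bellMax, add_mul, sub_mul, smul_mul_assoc, mul_assoc]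
  generalize √13 = r at hr h0 h1 h2 ⊢
  linear_combination (norm := (match_scalars <;> grind)) h0 - ((1 + r) / 8) • h2
    - (2 : ℝ) • (h1 - ((r - 4) / 12) • h2) + h2

/-- The last certificate polynomial, multiplied by p0 and by p1, expresses p0 p1 and p1 p0 through
the products of p's and q's. The first three polynomials reduce those products to linear terms,
which cancel. The factor (√13 - 1)/6 is the inverse of (1 + √13)/2. -/
theorem anticomm (h : OptimalRelations p0 p1 q0 q1 ρ) :
    p0 * (p1 * ρ) + p1 * (p0 * ρ) = (2 * cosAngle) • ρ := by
  have hr := sq_sqrt_thirteen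
  have h0 := h.cert 0
  have h1 := h.cert 1
  have h2 := h.cert 2
  have h4 := h.cert 4
  simp only [certificate, BilinearCoeff.eval, Matrix.cons_val, add_mul, smul_mul_assoc, one_mul,
    mul_assoc] at h0 h1 h2 h4
  have h5 := congrArg (p0 * ·) h4
  have h6 := congrArg (p1 * ·) h4
  simp only [mul_add, mul_smul_comm, h.sqP0, h.sqP1, mul_zero] at h5 h6
  simp only [cosAngle]
  generalize √13 = r at hr h0 h1 h2 h4 h5 h6 ⊢
  linear_combination (norm := (match_scalars <;> grind))
    ((1 + r) / 2) • (h0 - ((1 + r) / 8) • h2) + ((r - 1) / 6) • (h1 - ((r - 4) / 12) • h2) + h2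
      + h5 + ((r - 1) / 6) • h6

/-- On the state, the first pair acts like polynomials in the second pair. -/
theorem exists_transfer (h : OptimalRelations p0 p1 q0 q1 ρ) :
    (∃ f0 f1 f2 f3 : ℝ, p0 * ρ = (f0 • (1 : R) + f1 • q0 + f2 • q1 + f3 • (q0 * q1)) * ρ) ∧
    (∃ f0 f1 f2 f3 : ℝ, p1 * ρ = (f0 • (1 : R) + f1 • q0 + f2 • q1 + f3 • (q0 * q1)) * ρ) := by
  have hr := sq_sqrt_thirteen
  have h0 := h.cert 0
  have h2 := h.cert 2
  have h3 := h.cert 3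
  have h4 := h.cert 4
  have k00 : ∀ x, q0 * (p0 * x) = p0 * (q0 * x) := fun x => by
    rw [← mul_assoc, h.comm00, mul_assoc]
  have k10 : ∀ x, q0 * (p1 * x) = p1 * (q0 * x) := fun x => by
    rw [← mul_assoc, h.comm10, mul_assoc]
  simp only [certificate, BilinearCoeff.eval, Matrix.cons_val, add_mul, smul_mul_assoc, one_mul,
    mul_assoc] at h0 h2 h3 h4
  -- The products p0 q0 and p1 q0 occurring here are linear on ρ by the other polynomials. So this
  -- is a second relation between p0, p1, 1, q0, q1 and q0 q1, independent of `h4`, and the two can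
  -- be solved for p0 and p1.
  have h5 := congrArg (q0 * ·) h4
  simp only [mul_add, mul_smul_comm, h.sqQ0, k00, k10, mul_zero] at h5
  generalize √13 = r at hr h0 h2 h3 h4 h5
  constructor
  · refine ⟨(11 - 3 * r) / 12, (13 - r) / 12, (13 - r) / 12, (5 * r - 17) / 12, ?_⟩
    simp only [add_mul, smul_mul_assoc, one_mul, mul_assoc]
    linear_combination (norm := (match_scalars <;> grind))
      (r / 2 - 2) • (h0 - ((1 + r) / 8) • h2) + ((17 - 5 * r) / 24) • h2 + ((13 - r) / 24) • h4 +
        ((5 * r - 17) / 24) • (h3 + (1 / 3 : ℝ) • h4) + ((5 * r - 17) / 12) • h5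
  · refine ⟨(7 - 2 * r) / 6, 1 / 2, 1 - r / 2, r / 2 - 2, ?_⟩
    simp only [add_mul, smul_mul_assoc, one_mul, mul_assoc]
    linear_combination (norm := (match_scalars <;> grind))
      ((3 * r - 9) / 4) • (h0 - ((1 + r) / 8) • h2) +
        ((4 - r) / 4) • (h2 + h4 - h3 - (1 / 3 : ℝ) • h4) + (r / 2 - 2) • h5

end OptimalRelations
end Algebra

/-! ### Expectations -/

section Expectation

variable {ι : Type*} [Fintype ι]

open scoped MatrixOrder in
theorem exists_eq_conjTranspose_mul_self {M : Matrix ι ι ℂ} (hM : M.PosSemidef) :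
    ∃ N : Matrix ι ι ℂ, M = N.conjTranspose * N := by
  classical
  refine ⟨CFC.sqrt M, ?_⟩
  rw [(Matrix.nonneg_iff_posSemidef.1 (CFC.sqrt_nonneg M)).isHermitian.eq, 
    CFC.sqrt_mul_sqrt_self M hM.nonneg]

/-- The real part of the expectation of an operator in the state `ρ`. -/
def expect (ρ : Matrix ι ι ℂ) : Matrix ι ι ℂ →ₗ[ℝ] ℝ where
  toFun M := (ρ * M).trace.re
  map_add' M N := by simp [mul_add]
  map_smul' c M := by simp

theorem expect_apply (ρ M : Matrix ι ι ℂ) : expect ρ M = (ρ * M).trace.re := rfl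

theorem expect_conjTranspose_mul_self_nonneg {ρ : Matrix ι ι ℂ} (hρ : ρ.PosSemidef)
    {κ : Type*} [Fintype κ] (K : Matrix κ ι ℂ) : 0 ≤ expect ρ (K.conjTranspose * K) := by
  have h := (hρ.mul_mul_conjTranspose_same K).trace_nonneg
  rw [expect_apply, ← Matrix.mul_assoc, Matrix.trace_mul_comm, ← Matrix.mul_assoc]
  exact (Complex.le_def.1 h).1

/-- K ρ K† is positive with trace zero, hence zero; writing ρ = N† N gives K N† = 0. -/
theorem mul_eq_zero_of_expect_eq_zero {ρ : Matrix ι ι ℂ} (hρ : ρ.PosSemidef)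
    {κ : Type*} [Fintype κ] {K : Matrix κ ι ℂ} (h : expect ρ (K.conjTranspose * K) = 0) :
    K * ρ = 0 := by
  classical
  have hP := hρ.mul_mul_conjTranspose_same K
  rw [expect_apply, ← Matrix.mul_assoc, Matrix.trace_mul_comm, ← Matrix.mul_assoc] at h
  have h0 : (K * ρ * K.conjTranspose).trace = 0 := by
    have := Complex.le_def.1 hP.trace_nonneg
    exact Complex.ext h this.2.symm
  rw [hP.trace_eq_zero_iff] at h0
  obtain ⟨N, rfl⟩ := exists_eq_conjTranspose_mul_self hρ
  have h1 : (K * N.conjTranspose) * (K * N.conjTranspose).conjTranspose = 0 := by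
    rw [Matrix.conjTranspose_mul, Matrix.conjTranspose_conjTranspose, ← h0]
    simp only [Matrix.mul_assoc]
  rw [Matrix.self_mul_conjTranspose_eq_zero] at h1
  rw [← Matrix.mul_assoc, h1, Matrix.zero_mul]

theorem expect_nonneg {ρ M : Matrix ι ι ℂ} (hρ : ρ.PosSemidef) (hM : M.PosSemidef) :
    0 ≤ expect ρ M := by
  classical
  obtain ⟨N, rfl⟩ := exists_eq_conjTranspose_mul_self hM
  exact expect_conjTranspose_mul_self_nonneg hρ N

theorem mul_eq_zero_of_posSemidef {ρ M : Matrix ι ι ℂ} (hρ : ρ.PosSemidef) (hM : M.PosSemidef)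
    (h : expect ρ M = 0) : M * ρ = 0 := by
  classical
  obtain ⟨N, rfl⟩ := exists_eq_conjTranspose_mul_self hM
  rw [Matrix.mul_assoc, mul_eq_zero_of_expect_eq_zero hρ h, Matrix.mul_zero]

/-- Two commuting pairs of self-adjoint contractions. -/
structure Contractions [DecidableEq ι] (p0 p1 q0 q1 : Matrix ι ι ℂ) : Prop where
  hermP0 : p0.conjTranspose = p0
  hermP1 : p1.conjTranspose = p1
  hermQ0 : q0.conjTranspose = q0
  hermQ1 : q1.conjTranspose = q1
  comm00 : q0 * p0 = p0 * q0
  comm01 : q1 * p0 = p0 * q1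
  comm10 : q0 * p1 = p1 * q0
  comm11 : q1 * p1 = p1 * q1
  defectP0 : ∃ e : Matrix ι ι ℂ, e.conjTranspose * e = 1 - p0 * p0 ∧ q0 * e = e * q0 ∧
    q1 * e = e * q1
  defectP1 : ∃ e : Matrix ι ι ℂ, e.conjTranspose * e = 1 - p1 * p1 ∧ q0 * e = e * q0 ∧
    q1 * e = e * q1
  defectQ0 : ∃ f : Matrix ι ι ℂ, f.conjTranspose * f = 1 - q0 * q0
  defectQ1 : ∃ f : Matrix ι ι ℂ, f.conjTranspose * f = 1 - q1 * q1

variable [DecidableEq ι] {p0 p1 q0 q1 ρ : Matrix ι ι ℂ}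

/-- Only the square root of one defect has to commute with the other party's observable; this is why
`Contractions` asks for commutation on the p side only. -/
theorem defect_mul_defect_eq {p q e f : Matrix ι ι ℂ} (he : e.conjTranspose * e = 1 - p * p)
    (hq : q * e = e * q) (hf : f.conjTranspose * f = 1 - q * q) :
    (1 - p * p) * (1 - q * q) = (f * e).conjTranspose * (f * e) := by
  have h : (1 - q * q) * e = e * (1 - q * q) := by
    rw [sub_mul, mul_sub, one_mul, mul_one, mul_assoc, hq, ← mul_assoc, hq, mul_assoc]
  rw [Matrix.conjTranspose_mul, Matrix.mul_assoc, ← Matrix.mul_assoc f.conjTranspose, hf, h,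
    ← Matrix.mul_assoc, he]

theorem mul_defect_mul_eq {p e β : Matrix ι ι ℂ} (he : e.conjTranspose * e = 1 - p * p)
    (hβ : β.conjTranspose = β) : β * (1 - p * p) * β = (e * β).conjTranspose * (e * β) := by
  rw [Matrix.conjTranspose_mul, hβ, ← he]
  simp only [Matrix.mul_assoc]

namespace Contractions

/-- The expectation of a reduced square is nonnegative, and if it vanishes then so do the
expectations of the terms in which the square and the defects of the contractions occur. -/
theorem expect_reducedSq (h : Contractions p0 p1 q0 q1) (hρ : ρ.PosSemidef) (g : BilinearCoeff) :
    0 ≤ expect ρ (g.reducedSq p0 p1 q0 q1) ∧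
    (expect ρ (g.reducedSq p0 p1 q0 q1) = 0 →
      g.eval p0 p1 q0 q1 * ρ = 0 ∧
      (1 - p0 * p0) * (g.coeffP0 q0 q1 * ρ) = 0 ∧ (1 - p1 * p1) * (g.coeffP1 q0 q1 * ρ) = 0 ∧
      (1 - q0 * q0) * (g.coeffQ0 p0 p1 * ρ) = 0 ∧ (1 - q1 * q1) * (g.coeffQ1 p0 p1 * ρ) = 0) := by
  obtain ⟨e0, he0, he00, he01⟩ := h.defectP0
  obtain ⟨e1, he1, he10, he11⟩ := h.defectP1
  obtain ⟨f0, hf0⟩ := h.defectQ0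
  obtain ⟨f1, hf1⟩ := h.defectQ1
  have hL : (g.eval p0 p1 q0 q1).conjTranspose = g.eval p0 p1 q0 q1 := by
    simp [BilinearCoeff.eval, h.hermP0, h.hermP1, h.hermQ0, h.hermQ1, h.comm00, h.comm01,
      h.comm10, h.comm11]
  have hP0 : (g.coeffP0 q0 q1).conjTranspose = g.coeffP0 q0 q1 := by
    simp [BilinearCoeff.coeffP0, h.hermQ0, h.hermQ1]
  have hP1 : (g.coeffP1 q0 q1).conjTranspose = g.coeffP1 q0 q1 := by
    simp [BilinearCoeff.coeffP1, h.hermQ0, h.hermQ1]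
  have hQ0 : (g.coeffQ0 p0 p1).conjTranspose = g.coeffQ0 p0 p1 := by
    simp [BilinearCoeff.coeffQ0, h.hermP0, h.hermP1]
  have hQ1 : (g.coeffQ1 p0 p1).conjTranspose = g.coeffQ1 p0 p1 := by
    simp [BilinearCoeff.coeffQ1, h.hermP0, h.hermP1]
  have hsq : g.eval p0 p1 q0 q1 * g.eval p0 p1 q0 q1 =
      (g.eval p0 p1 q0 q1).conjTranspose * g.eval p0 p1 q0 q1 := by rw [hL]
  rw [g.reducedSq_eq h.comm00 h.comm01 h.comm10 h.comm11, hsq, mul_defect_mul_eq he0 hP0,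
    mul_defect_mul_eq he1 hP1, mul_defect_mul_eq hf0 hQ0, mul_defect_mul_eq hf1 hQ1,
    defect_mul_defect_eq he0 he00 hf0, defect_mul_defect_eq he0 he01 hf1,
    defect_mul_defect_eq he1 he10 hf0, defect_mul_defect_eq he1 he11 hf1]
  simp only [map_add, map_smul, smul_eq_mul]
  have n1 := expect_conjTranspose_mul_self_nonneg hρ (g.eval p0 p1 q0 q1)
  have n2 := expect_conjTranspose_mul_self_nonneg hρ (e0 * g.coeffP0 q0 q1)
  have n3 := expect_conjTranspose_mul_self_nonneg hρ (e1 * g.coeffP1 q0 q1)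
  have n4 := expect_conjTranspose_mul_self_nonneg hρ (f0 * g.coeffQ0 p0 p1)
  have n5 := expect_conjTranspose_mul_self_nonneg hρ (f1 * g.coeffQ1 p0 p1)
  have n6 := mul_nonneg (sq_nonneg g.c00) (expect_conjTranspose_mul_self_nonneg hρ (f0 * e0))
  have n7 := mul_nonneg (sq_nonneg g.c01) (expect_conjTranspose_mul_self_nonneg hρ (f1 * e0))
  have n8 := mul_nonneg (sq_nonneg g.c10) (expect_conjTranspose_mul_self_nonneg hρ (f0 * e1))
  have n9 := mul_nonneg (sq_nonneg g.c11) (expect_conjTranspose_mul_self_nonneg hρ (f1 * e1))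
  have key : ∀ e β : Matrix ι ι ℂ, expect ρ ((e * β).conjTranspose * (e * β)) = 0 →
      e.conjTranspose * e * (β * ρ) = 0 := fun e β h0 => by
    rw [Matrix.mul_assoc, ← Matrix.mul_assoc e, mul_eq_zero_of_expect_eq_zero hρ h0,
      Matrix.mul_zero]
  refine ⟨by linarith, fun h0 => ⟨mul_eq_zero_of_expect_eq_zero hρ (by linarith), ?_, ?_, ?_, ?_⟩⟩
  · rw [← he0]; exact key _ _ (by linarith)
  · rw [← he1]; exact key _ _ (by linarith)
  · rw [← hf0]; exact key _ _ (by linarith)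
  · rw [← hf1]; exact key _ _ (by linarith)

theorem expect_bellMax_sub_nonneg (h : Contractions p0 p1 q0 q1) (hρ : ρ.PosSemidef) :
    0 ≤ expect ρ (bellMax • (1 : Matrix ι ι ℂ) - bellPoly p0 p1 q0 q1) := by
  rw [← sum_weight_smul_reducedSq]
  simp only [map_sum, map_smul, smul_eq_mul]
  exact Finset.sum_nonneg fun k _ =>
    mul_nonneg (weight_pos k).le (h.expect_reducedSq hρ (certificate k)).1

/-- Equality in the certificate forces each nonnegative summand to vanish, since all weights are
strictly positive. -/
theorem optimalRelations (h : Contractions p0 p1 q0 q1) (hρ : ρ.PosSemidef)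
    (htr : ρ.trace = 1) (hopt : expect ρ (bellPoly p0 p1 q0 q1) = bellMax) :
    OptimalRelations p0 p1 q0 q1 ρ := by
  have hs := congrArg (expect ρ) (sum_weight_smul_reducedSq p0 p1 q0 q1)
  have h1 : expect ρ 1 = 1 := by simp [expect_apply, htr]
  simp only [map_sum, map_smul, map_sub, smul_eq_mul, h1, hopt, mul_one, sub_self] at hs
  rw [Finset.sum_eq_zero_iff_of_nonneg fun k _ =>
    mul_nonneg (weight_pos k).le (h.expect_reducedSq hρ (certificate k)).1] at hs
  have h0 : ∀ k, expect ρ ((certificate k).reducedSq p0 p1 q0 q1) = 0 := fun k =>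
    (mul_eq_zero.1 (hs k (Finset.mem_univ k))).resolve_left (weight_pos k).ne'
  have hsq : ∀ {p : Matrix ι ι ℂ} {s : ℝ}, s ≠ 0 → (1 - p * p) * (s • ρ) = 0 →
      p * (p * ρ) = ρ := fun hs0 hz => by
    rw [Matrix.mul_smul, smul_eq_zero_iff_right hs0, sub_mul, one_mul, sub_eq_zero, mul_assoc] at hz
    exact hz.symm
  have hκ : (1 + √13) / 2 ≠ 0 := by positivity
  -- The last polynomial is purely linear, so its coefficients of p0, p1, q0, q1 are nonzero
  -- scalars, and its defect terms say directly that each observable squares to one on ρ.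
  obtain ⟨-, z1, z2, z3, z4⟩ := (h.expect_reducedSq hρ (certificate 4)).2 (h0 4)
  refine ⟨h.comm00, h.comm01, h.comm10, h.comm11, hsq hκ ?_, hsq one_ne_zero ?_,
    hsq (s := -(1 + √13) / 2) (by rw [neg_div]; exact neg_ne_zero.2 hκ) ?_, hsq (neg_ne_zero.2 one_ne_zero) ?_,
    fun k => ((h.expect_reducedSq hρ (certificate k)).2 (h0 k)).1⟩
  · simpa [BilinearCoeff.coeffP0, certificate] using z1
  · simpa [BilinearCoeff.coeffP1, certificate] using z2
  · simpa [BilinearCoeff.coeffQ0, certificate] using z3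
  · simpa [BilinearCoeff.coeffQ1, certificate] using z4

end Contractions
end Expectation

/-! ### Observables of a strategy -/

/-- The observable of a two-outcome measurement. -/
def obs {ι : Type*} (M : Fin 2 → Matrix ι ι ℂ) : Matrix ι ι ℂ := M 0 - M 1

section POVM

variable {ι : Type} [Fintype ι] [DecidableEq ι] {M : Fin 2 → Matrix ι ι ℂ}

theorem IsPOVM.eq_one_sub (h : IsPOVM M) : M 1 = 1 - M 0 := by
  rw [← h.2, Fin.sum_univ_two, add_sub_cancel_left]

theorem IsPOVM.conjTranspose_obs (h : IsPOVM M) : (obs M).conjTranspose = obs M := by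
  rw [obs, Matrix.conjTranspose_sub, (h.1 0).isHermitian.eq, (h.1 1).isHermitian.eq]

/-- For commuting effects with sum one, 1 - (M₀ - M₁)² = 4 M₀ M₁ = 4 (M₀ M₁ M₀ + M₁ M₀ M₁), which is
visibly positive. -/
theorem IsPOVM.exists_defect (h : IsPOVM M) :
    ∃ e : Matrix ι ι ℂ, e.conjTranspose * e = 1 - obs M * obs M := by
  have h0 := (h.1 1).conjTranspose_mul_mul_same (M 0)
  have h1 := (h.1 0).conjTranspose_mul_mul_same (M 1)
  rw [(h.1 0).isHermitian.eq] at h0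
  rw [(h.1 1).isHermitian.eq] at h1
  have h2 : 1 - obs M * obs M =
      (M 0 * M 1 * M 0 + M 1 * M 0 * M 1) + (M 0 * M 1 * M 0 + M 1 * M 0 * M 1) +
      ((M 0 * M 1 * M 0 + M 1 * M 0 * M 1) + (M 0 * M 1 * M 0 + M 1 * M 0 * M 1)) := by
    rw [obs, h.eq_one_sub]; noncomm_ring
  obtain ⟨e, he⟩ := exists_eq_conjTranspose_mul_self
    (((h0.add h1).add (h0.add h1)).add ((h0.add h1).add (h0.add h1)))
  exact ⟨e, by rw [h2, he]⟩

theorem IsPOVM.eq_obs (h : IsPOVM M) (a : Fin 2) :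
    M a = (1 / 2 : ℂ) • (1 + (-1 : ℂ) ^ (a : ℕ) • obs M) := by
  have h1 := h.eq_one_sub
  fin_cases a
  · simp only [obs, h1, Fin.zero_eta, pow_zero]; module
  · simp only [obs, Fin.mk_one, pow_one]; rw [h1]; module

end POVM

theorem sub_kronecker {ι κ : Type*} (M M' : Matrix ι ι ℂ) (N : Matrix κ κ ℂ) :
    (M - M') ⊗ₖ N = M ⊗ₖ N - M' ⊗ₖ N := by
  ext; simp [sub_mul]

theorem kronecker_sub {ι κ : Type*} (M : Matrix ι ι ℂ) (N N' : Matrix κ κ ℂ) :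
    M ⊗ₖ (N - N') = M ⊗ₖ N - M ⊗ₖ N' := by
  ext; simp [mul_sub]

theorem kronecker_one_mul_one_kronecker {ι κ : Type*} [Fintype ι] [Fintype κ] [DecidableEq ι]
    [DecidableEq κ] (M : Matrix ι ι ℂ) (N : Matrix κ κ ℂ) :
    (M ⊗ₖ (1 : Matrix κ κ ℂ)) * ((1 : Matrix ι ι ℂ) ⊗ₖ N) = M ⊗ₖ N := by
  rw [← Matrix.mul_kronecker_mul, mul_one, one_mul]

theorem one_kronecker_mul_kronecker_one {ι κ : Type*} [Fintype ι] [Fintype κ] [DecidableEq ι]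
    [DecidableEq κ] (M : Matrix ι ι ℂ) (N : Matrix κ κ ℂ) :
    ((1 : Matrix ι ι ℂ) ⊗ₖ N) * (M ⊗ₖ (1 : Matrix κ κ ℂ)) = M ⊗ₖ N := by
  rw [← Matrix.mul_kronecker_mul, mul_one, one_mul]

namespace Strategy

variable {m n : ℕ} (S : Strategy m n)

/-- Alice's observables, acting on the joint system. -/
def opA (x : Fin 2) : Matrix (Fin m × Fin n) (Fin m × Fin n) ℂ := obs (S.A x) ⊗ₖ 1

/-- Bob's observables, acting on the joint system. -/
def opB (y : Fin 2) : Matrix (Fin m × Fin n) (Fin m × Fin n) ℂ := 1 ⊗ₖ obs (S.B y)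

/-- The Bell polynomial of the game at the observables of a strategy. -/
def bell : Matrix (Fin m × Fin n) (Fin m × Fin n) ℂ :=
  bellPoly (S.opA 0) (S.opA 1) (-S.opB 1) (S.opB 0)

variable {S}

theorem IsQuantum.contractions (h : S.IsQuantum) :
    Contractions (S.opA 0) (S.opA 1) (-S.opB 1) (S.opB 0) := by
  have hA : ∀ x, (S.opA x).conjTranspose = S.opA x := fun x => by
    rw [opA, Matrix.conjTranspose_kronecker, (h.alice x).conjTranspose_obs,
      Matrix.conjTranspose_one]
  have hB : ∀ y, (S.opB y).conjTranspose = S.opB y := fun y => by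
    rw [opB, Matrix.conjTranspose_kronecker, (h.bob y).conjTranspose_obs,
      Matrix.conjTranspose_one]
  have hc : ∀ x y, S.opB y * S.opA x = S.opA x * S.opB y := fun x y => by
    rw [opA, opB, one_kronecker_mul_kronecker_one, kronecker_one_mul_one_kronecker]
  have dA : ∀ x, ∃ e : Matrix (Fin m × Fin n) (Fin m × Fin n) ℂ,
      e.conjTranspose * e = 1 - S.opA x * S.opA x ∧ -S.opB 1 * e = e * -S.opB 1 ∧
        S.opB 0 * e = e * S.opB 0 := fun x => by
    obtain ⟨e, he⟩ := (h.alice x).exists_defect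
    refine ⟨e ⊗ₖ 1, ?_, ?_, ?_⟩
    · rw [Matrix.conjTranspose_kronecker, Matrix.conjTranspose_one, ← Matrix.mul_kronecker_mul, he,
        opA, ← Matrix.mul_kronecker_mul, mul_one, sub_kronecker, Matrix.one_kronecker_one]
    · rw [neg_mul, mul_neg, opB, one_kronecker_mul_kronecker_one, kronecker_one_mul_one_kronecker]
    · rw [opB, one_kronecker_mul_kronecker_one, kronecker_one_mul_one_kronecker]
  have dB : ∀ y, ∃ f : Matrix (Fin m × Fin n) (Fin m × Fin n) ℂ,
      f.conjTranspose * f = 1 - S.opB y * S.opB y := fun y => by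
    obtain ⟨f, hf⟩ := (h.bob y).exists_defect
    refine ⟨1 ⊗ₖ f, ?_⟩
    rw [Matrix.conjTranspose_kronecker, Matrix.conjTranspose_one, ← Matrix.mul_kronecker_mul, hf,
      opB, ← Matrix.mul_kronecker_mul, mul_one, kronecker_sub, Matrix.one_kronecker_one]
  refine ⟨hA 0, hA 1, by rw [Matrix.conjTranspose_neg, hB], hB 0, ?_, hc 0 0, ?_, hc 1 0, dA 0,
    dA 1, ?_, dB 0⟩
  · rw [neg_mul, mul_neg, hc]
  · rw [neg_mul, mul_neg, hc]
  · rw [neg_mul_neg]; exact dB 1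

theorem IsQuantum.value_eq (h : S.IsQuantum) : S.value = (5 + expect S.ρ S.bell) / 16 := by
  have h1 : expect S.ρ 1 = 1 := by simp [expect_apply, h.state.2]
  have hb : ∀ a b x y, S.box a b x y = expect S.ρ (S.A x a ⊗ₖ S.B y b) := fun _ _ _ _ => rfl
  have hA := fun x => (h.alice x).eq_one_sub
  have hB := fun y => (h.bob y).eq_one_sub
  simp only [value, gameValue, bell, bellPoly, opA, opB, mul_neg, kronecker_one_mul_one_kronecker,
    Fin.sum_univ_two, V, hb]
  simp only [obs, hA, hB, sub_kronecker, kronecker_sub, Matrix.one_kronecker_one, map_add, map_sub,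
    map_neg, map_smul, h1]
  norm_num
  ring

theorem IsQuantum.value_le (h : S.IsQuantum) : S.value ≤ omegaQ := by
  have h1 : expect S.ρ 1 = 1 := by simp [expect_apply, h.state.2]
  have := h.contractions.expect_bellMax_sub_nonneg h.state.1
  rw [map_sub, map_smul, h1, bellMax, smul_eq_mul] at this
  rw [h.value_eq, bell, omegaQ]
  linarith

theorem IsQuantum.optimalRelations (h : S.IsQuantum) (hv : S.value = omegaQ) :
    OptimalRelations (S.opA 0) (S.opA 1) (-S.opB 1) (S.opB 0) S.ρ := by
  refine h.contractions.optimalRelations h.state.1 h.state.2 ?_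
  rw [h.value_eq, bell, omegaQ] at hv
  rw [bellMax]
  linarith

end Strategy

/-! ### Partial traces and supports -/

section PartialTrace

variable {m n : ℕ}

theorem traceB_kronecker_one_mul (K : Matrix (Fin m) (Fin m) ℂ)
    (X : Matrix (Fin m × Fin n) (Fin m × Fin n) ℂ) :
    traceB ((K ⊗ₖ (1 : Matrix (Fin n) (Fin n) ℂ)) * X) = K * traceB X := by
  ext i i'
  simp only [traceB, Matrix.mul_apply, Fintype.sum_prod_type, Matrix.kroneckerMap_apply,
    Matrix.one_apply, mul_ite, mul_one, mul_zero, ite_mul, zero_mul, Finset.sum_ite_eq,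
    Finset.mem_univ, if_true, Finset.mul_sum]
  exact Finset.sum_comm

theorem traceA_one_kronecker_mul (K : Matrix (Fin n) (Fin n) ℂ)
    (X : Matrix (Fin m × Fin n) (Fin m × Fin n) ℂ) :
    traceA (((1 : Matrix (Fin m) (Fin m) ℂ) ⊗ₖ K) * X) = K * traceA X := by
  ext j j'
  simp only [traceA, Matrix.mul_apply, Fintype.sum_prod_type, Matrix.kroneckerMap_apply,
    Matrix.one_apply, ite_mul, one_mul, zero_mul, Finset.mul_sum]
  refine Eq.trans (Finset.sum_congr rfl fun i _ => ?_) Finset.sum_comm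
  rw [Finset.sum_eq_single i]
  · simp
  · intro b _ hb; simp [Ne.symm hb]
  · simp

theorem trace_traceB (X : Matrix (Fin m × Fin n) (Fin m × Fin n) ℂ) :
    (traceB X).trace = X.trace := by
  simp [traceB, Matrix.trace, Fintype.sum_prod_type]

theorem trace_traceA (X : Matrix (Fin m × Fin n) (Fin m × Fin n) ℂ) :
    (traceA X).trace = X.trace := by
  simp only [traceA, Matrix.trace, Fintype.sum_prod_type, Matrix.diag_apply]
  exact Finset.sum_comm

theorem posSemidef_traceB {X : Matrix (Fin m × Fin n) (Fin m × Fin n) ℂ} (hX : X.PosSemidef) :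
    (traceB X).PosSemidef := by
  have : traceB X = ∑ j, X.submatrix (fun i => (i, j)) (fun i => (i, j)) := by
    ext i i'; simp [traceB, Matrix.sum_apply]
  rw [this]
  exact Matrix.posSemidef_sum _ fun j _ => hX.submatrix _

theorem posSemidef_traceA {X : Matrix (Fin m × Fin n) (Fin m × Fin n) ℂ} (hX : X.PosSemidef) :
    (traceA X).PosSemidef := by
  have : traceA X = ∑ i, X.submatrix (fun j => (i, j)) (fun j => (i, j)) := by
    ext i i'; simp [traceA, Matrix.sum_apply]
  rw [this]
  exact Matrix.posSemidef_sum _ fun j _ => hX.submatrix _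

end PartialTrace

/-- The orthogonal projection onto the range of a Hermitian matrix. -/
theorem exists_range_projection {ι : Type*} [Fintype ι] [DecidableEq ι] {H : Matrix ι ι ℂ}
    (hH : H.IsHermitian) :
    ∃ P M : Matrix ι ι ℂ, P.conjTranspose = P ∧ P * P = P ∧ P * H = H ∧ P = H * M := by
  obtain ⟨U, d, hU, hU', hd⟩ : ∃ (U : Matrix ι ι ℂ) (d : ι → ℝ), U.conjTranspose * U = 1 ∧
      U * U.conjTranspose = 1 ∧
      H = U * Matrix.diagonal (fun i => (d i : ℂ)) * U.conjTranspose := by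
    refine ⟨hH.eigenvectorUnitary, hH.eigenvalues, ?_, ?_, ?_⟩
    · exact Unitary.coe_star_mul_self hH.eigenvectorUnitary
    · exact Unitary.coe_mul_star_self hH.eigenvectorUnitary
    · exact hH.spectral_theorem
  have key : ∀ c c' : ι → ℂ, (U * Matrix.diagonal c * U.conjTranspose) *
      (U * Matrix.diagonal c' * U.conjTranspose) =
      U * Matrix.diagonal (fun i => c i * c' i) * U.conjTranspose := fun c c' => by
    rw [← Matrix.diagonal_mul_diagonal]
    calc _ = U * Matrix.diagonal c * (U.conjTranspose * U) * Matrix.diagonal c' *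
          U.conjTranspose := by simp only [Matrix.mul_assoc]
      _ = _ := by rw [hU, Matrix.mul_one, Matrix.mul_assoc U]
  -- The convention 0⁻¹ = 0 makes d d⁻¹ the indicator of the nonzero eigenvalues and the second
  -- witness a pseudo-inverse.
  refine ⟨U * Matrix.diagonal (fun i => (d i : ℂ) * (d i : ℂ)⁻¹) * U.conjTranspose,
    U * Matrix.diagonal (fun i => (d i : ℂ)⁻¹) * U.conjTranspose, ?_, ?_, ?_, ?_⟩
  · simp only [Matrix.conjTranspose_mul, Matrix.conjTranspose_conjTranspose,
      Matrix.diagonal_conjTranspose, Matrix.mul_assoc]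
    congr 3
    ext i
    simp
  · rw [key]
    congr 3
    ext i
    by_cases h : (d i : ℂ) = 0 <;> simp [h]
  · rw [hd, key]
    congr 3
    ext i
    by_cases h : (d i : ℂ) = 0 <;> simp [h]
  · rw [hd, key]

/-- The relations between two observables on the range of a projection `P`, up to unitary
equivalence those of qubit observables at angle `alpha 1`. -/
structure LocalRelations {ι : Type*} [Fintype ι] [DecidableEq ι] (a0 a1 P : Matrix ι ι ℂ) :
    Prop where
  herm0 : a0.conjTranspose = a0
  herm1 : a1.conjTranspose = a1
  hermP : P.conjTranspose = P
  idem : P * P = P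
  comm0 : a0 * P = P * a0
  comm1 : a1 * P = P * a1
  sq0 : a0 * (a0 * P) = P
  sq1 : a1 * (a1 * P) = P
  anticomm : a0 * (a1 * P) + a1 * (a0 * P) = (2 * cosAngle) • P

theorem LocalRelations.symm {ι : Type*} [Fintype ι] [DecidableEq ι] {a0 a1 P : Matrix ι ι ℂ}
    (h : LocalRelations a0 a1 P) : LocalRelations a1 a0 P :=
  ⟨h.herm1, h.herm0, h.hermP, h.idem, h.comm1, h.comm0, h.sq1, h.sq0, by
    rw [add_comm, h.anticomm]⟩

/-- P is the support projection of Alice's marginal. An operator K with (K ⊗ 1) ρ = 0 kills the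
marginal and hence P, so relations on ρ descend to relations on P. -/
theorem OptimalRelations.exists_localRelations {m n : ℕ} {a0 a1 : Matrix (Fin m) (Fin m) ℂ}
    {b0 b1 : Matrix (Fin n) (Fin n) ℂ} {ρ : Matrix (Fin m × Fin n) (Fin m × Fin n) ℂ}
    (h : OptimalRelations (a0 ⊗ₖ 1) (a1 ⊗ₖ 1) (1 ⊗ₖ b0) (1 ⊗ₖ b1) ρ) (hρ : ρ.PosSemidef)
    (h0 : a0.conjTranspose = a0) (h1 : a1.conjTranspose = a1) :
    ∃ P, LocalRelations a0 a1 P ∧ (P ⊗ₖ (1 : Matrix (Fin n) (Fin n) ℂ)) * ρ = ρ := by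
  obtain ⟨P, M, hP, hPP, hPr, hM⟩ := exists_range_projection (posSemidef_traceB hρ).isHermitian
  have hzero : ∀ K : Matrix (Fin m) (Fin m) ℂ,
      (K ⊗ₖ (1 : Matrix (Fin n) (Fin n) ℂ)) * ρ = 0 → K * P = 0 := fun K hK => by
    have := congrArg traceB hK
    rw [traceB_kronecker_one_mul] at this
    rw [hM, ← Matrix.mul_assoc, this]
    ext i j
    simp [traceB, Matrix.mul_apply]
  have hQ : ((1 - P) ⊗ₖ (1 : Matrix (Fin n) (Fin n) ℂ)) * ρ = 0 := by
    apply mul_eq_zero_of_expect_eq_zero hρ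
    have hQQ : (1 - P) * (1 - P) = 1 - P := by
      rw [sub_mul, one_mul, mul_sub, mul_one, hPP, sub_self, sub_zero]
    rw [Matrix.conjTranspose_kronecker, Matrix.conjTranspose_sub, Matrix.conjTranspose_one,
      Matrix.conjTranspose_one, hP, ← Matrix.mul_kronecker_mul, hQQ, mul_one, expect_apply,
      Matrix.trace_mul_comm, ← trace_traceB, traceB_kronecker_one_mul, sub_mul, one_mul, hPr,
      sub_self, Matrix.trace_zero, Complex.zero_re]
  have hPρ : (P ⊗ₖ (1 : Matrix (Fin n) (Fin n) ℂ)) * ρ = ρ := by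
    rw [sub_kronecker, Matrix.one_kronecker_one, sub_mul, one_mul, sub_eq_zero] at hQ
    exact hQ.symm
  have hcomm : ∀ a : Matrix (Fin m) (Fin m) ℂ, a.conjTranspose = a →
      (∃ f0 f1 f2 f3 : ℝ, (a ⊗ₖ (1 : Matrix (Fin n) (Fin n) ℂ)) * ρ =
        (f0 • (1 : Matrix (Fin m × Fin n) (Fin m × Fin n) ℂ) + f1 • (1 ⊗ₖ b0) + f2 • (1 ⊗ₖ b1) +
          f3 • ((1 ⊗ₖ b0) * (1 ⊗ₖ b1))) * ρ) → a * P = P * a := by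
    rintro a ha ⟨f0, f1, f2, f3, hf⟩
    -- On ρ the observable a equals an operator on Bob's side, which commutes with (1 - P) ⊗ 1, and
    -- that annihilates ρ. So a preserves the range of P, and being self-adjoint it commutes with P.
    have hz : ((1 - P) * a) * P = 0 := by
      apply hzero
      have hb : ∀ (b : Matrix (Fin n) (Fin n) ℂ) X, ((1 - P) ⊗ₖ (1 : Matrix (Fin n) (Fin n) ℂ)) *
          (((1 : Matrix (Fin m) (Fin m) ℂ) ⊗ₖ b) * X) =
          (1 ⊗ₖ b) * (((1 - P) ⊗ₖ (1 : Matrix (Fin n) (Fin n) ℂ)) * X) := fun b X => by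
        rw [← Matrix.mul_assoc, ← Matrix.mul_assoc, kronecker_one_mul_one_kronecker,
          one_kronecker_mul_kronecker_one]
      have hk : ((1 - P) * a) ⊗ₖ (1 : Matrix (Fin n) (Fin n) ℂ) =
          ((1 - P) ⊗ₖ 1) * (a ⊗ₖ 1) := by rw [← Matrix.mul_kronecker_mul, mul_one]
      rw [hk, Matrix.mul_assoc, hf]
      simp only [add_mul, mul_add, smul_mul_assoc, mul_smul_comm, one_mul, mul_assoc, hb, hQ,
        mul_zero, smul_zero, add_zero]
    rw [sub_mul, one_mul, sub_mul, sub_eq_zero] at hz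
    have hz' := congrArg Matrix.conjTranspose hz
    simp only [Matrix.conjTranspose_mul, hP, ha] at hz'
    rw [hz', ← Matrix.mul_assoc, hz]
  have hone : ∀ K : Matrix (Fin m) (Fin m) ℂ, ∀ s : ℝ,
      (K ⊗ₖ (1 : Matrix (Fin n) (Fin n) ℂ)) * ρ = s • ρ → K * P = s • P := fun K s hK => by
    have h2 := hzero (K - s • 1) (by
      rw [sub_kronecker, Matrix.smul_kronecker, Matrix.one_kronecker_one, sub_mul, hK,
        smul_mul_assoc, one_mul, sub_self])
    rwa [sub_mul, smul_mul_assoc, one_mul, sub_eq_zero] at h2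
  have hmul : ∀ K L : Matrix (Fin m) (Fin m) ℂ, (K * L) ⊗ₖ (1 : Matrix (Fin n) (Fin n) ℂ) =
      (K ⊗ₖ 1) * (L ⊗ₖ 1) := fun K L => by rw [← Matrix.mul_kronecker_mul, mul_one]
  refine ⟨P, ⟨h0, h1, hP, hPP, hcomm a0 h0 h.exists_transfer.1, hcomm a1 h1 h.exists_transfer.2,
    ?_, ?_, ?_⟩, hPρ⟩
  · rw [← Matrix.mul_assoc, hone (a0 * a0) 1, one_smul]
    rw [hmul, Matrix.mul_assoc, h.sqP0, one_smul]
  · rw [← Matrix.mul_assoc, hone (a1 * a1) 1, one_smul]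
    rw [hmul, Matrix.mul_assoc, h.sqP1, one_smul]
  · rw [← Matrix.mul_assoc, ← Matrix.mul_assoc, ← add_mul]
    apply hone
    rw [Matrix.add_kronecker, hmul, hmul, add_mul, Matrix.mul_assoc, Matrix.mul_assoc, h.anticomm]

theorem OptimalRelations.map {R R' : Type*} [Ring R] [Algebra ℝ R] [Ring R'] [Algebra ℝ R']
    {p0 p1 q0 q1 ρ : R} (h : OptimalRelations p0 p1 q0 q1 ρ) (f : R →ₐ[ℝ] R') :
    OptimalRelations (f p0) (f p1) (f q0) (f q1) (f ρ) where
  comm00 := by simp only [← map_mul, h.comm00]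
  comm01 := by simp only [← map_mul, h.comm01]
  comm10 := by simp only [← map_mul, h.comm10]
  comm11 := by simp only [← map_mul, h.comm11]
  sqP0 := by simp only [← map_mul, h.sqP0]
  sqP1 := by simp only [← map_mul, h.sqP1]
  sqQ0 := by simp only [← map_mul, h.sqQ0]
  sqQ1 := by simp only [← map_mul, h.sqQ1]
  cert k := by
    have hk := congrArg f (h.cert k)
    simpa only [BilinearCoeff.eval, map_mul, map_add, map_smul, map_one, map_zero] using hk

theorem OptimalRelations.exists_localRelations_right {m n : ℕ} {a0 a1 : Matrix (Fin m) (Fin m) ℂ}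
    {b0 b1 : Matrix (Fin n) (Fin n) ℂ} {ρ : Matrix (Fin m × Fin n) (Fin m × Fin n) ℂ}
    (h : OptimalRelations (a0 ⊗ₖ 1) (a1 ⊗ₖ 1) (1 ⊗ₖ b0) (1 ⊗ₖ b1) ρ) (hρ : ρ.PosSemidef)
    (h0 : b0.conjTranspose = b0) (h1 : b1.conjTranspose = b1) :
    ∃ P, LocalRelations b0 b1 P ∧ ((1 : Matrix (Fin m) (Fin m) ℂ) ⊗ₖ P) * ρ = ρ := by
  have hs : OptimalRelations (((1 : Matrix (Fin m) (Fin m) ℂ) ⊗ₖ b0).submatrix Prod.swap Prod.swap)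
      (((1 : Matrix (Fin m) (Fin m) ℂ) ⊗ₖ b1).submatrix Prod.swap Prod.swap)
      ((a0 ⊗ₖ (1 : Matrix (Fin n) (Fin n) ℂ)).submatrix Prod.swap Prod.swap)
      ((a1 ⊗ₖ (1 : Matrix (Fin n) (Fin n) ℂ)).submatrix Prod.swap Prod.swap)
      (ρ.submatrix Prod.swap Prod.swap) :=
    h.symm.map (Matrix.reindexAlgEquiv ℝ ℂ (Equiv.prodComm (Fin m) (Fin n))).toAlgHom
  have hl : ∀ b : Matrix (Fin n) (Fin n) ℂ,
      ((1 : Matrix (Fin m) (Fin m) ℂ) ⊗ₖ b).submatrix Prod.swap Prod.swap = b ⊗ₖ 1 := fun b => by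
    ext ⟨i, j⟩ ⟨i', j'⟩; simp [mul_comm]
  have hr : ∀ a : Matrix (Fin m) (Fin m) ℂ,
      (a ⊗ₖ (1 : Matrix (Fin n) (Fin n) ℂ)).submatrix Prod.swap Prod.swap = 1 ⊗ₖ a := fun a => by
    ext ⟨i, j⟩ ⟨i', j'⟩; simp [mul_comm]
  rw [hl, hl, hr, hr] at hs
  obtain ⟨P, hP, hPρ⟩ := hs.exists_localRelations (hρ.submatrix _) h0 h1
  refine ⟨P, hP, ?_⟩
  have hsub := congrArg (Matrix.reindexAlgEquiv ℝ ℂ (Equiv.prodComm (Fin n) (Fin m))) hPρ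
  rw [map_mul] at hsub
  have hP' : (P ⊗ₖ (1 : Matrix (Fin m) (Fin m) ℂ)).submatrix Prod.swap Prod.swap = 1 ⊗ₖ P := by
    ext ⟨i, j⟩ ⟨i', j'⟩; simp [mul_comm]
  rw [← hP']
  exact hsub

/-! ### The qubit observables -/

/-- The phase `e^{iα₁}`. -/
def phase : ℂ := Complex.exp (Complex.I * (alpha 1 : ℂ))

theorem cos_alpha_one : Real.cos (alpha 1) = cosAngle := by
  have hr := sq_sqrt_thirteen
  have h : (0 : ℝ) ≤ (5 + √13) / 6 := by positivity
  have h11 : (11 + √13 : ℝ) ≠ 0 := by positivity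
  have : alpha 1 = 2 * Real.arctan √((5 + √13) / 6) := by simp [alpha]
  rw [this, Real.cos_two_mul, Real.cos_sq_arctan, Real.sq_sqrt h, cosAngle]
  have h2 : (1 + (5 + √13) / 6 : ℝ) = (11 + √13) / 6 := by ring
  rw [h2]
  field_simp
  linear_combination hr

theorem sin_alpha_one_pos : 0 < Real.sin (alpha 1) := by
  have : alpha 1 = 2 * Real.arctan √((5 + √13) / 6) := by simp [alpha]
  rw [this, Real.sin_two_mul]
  have h1 : 0 < Real.arctan √((5 + √13) / 6) := Real.arctan_pos.2 (by positivity)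
  have h2 := Real.sin_pos_of_pos_of_lt_pi h1
    ((Real.arctan_lt_pi_div_two _).trans (by linarith [Real.pi_pos]))
  have h3 := Real.cos_arctan_pos √((5 + √13) / 6)
  positivity

theorem phase_re : phase.re = cosAngle := by
  rw [phase, mul_comm, Complex.exp_ofReal_mul_I_re, cos_alpha_one]

theorem phase_im_pos : 0 < phase.im := by
  rw [phase, mul_comm, Complex.exp_ofReal_mul_I_im]
  exact sin_alpha_one_pos

/-- Eliminating the conjugate makes the later identities polynomial in `phase` and √13, to be
checked modulo their two quadratic equations. -/
theorem star_phase : star phase = 2 * (cosAngle : ℂ) - phase := by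
  apply Complex.ext
  · simp [phase_re]; ring
  · simp

theorem exp_neg_alpha_one :
    Complex.exp (-(Complex.I * (alpha 1 : ℂ))) = 2 * (cosAngle : ℂ) - phase := by
  rw [← star_phase, phase, Complex.star_def, ← Complex.exp_conj]
  simp

theorem phase_mul_phase : phase * phase = 2 * (cosAngle : ℂ) * phase - 1 := by
  have h : phase * Complex.exp (-(Complex.I * (alpha 1 : ℂ))) = 1 := by
    rw [phase, ← Complex.exp_add, add_neg_cancel, Complex.exp_zero]
  rw [exp_neg_alpha_one] at h
  linear_combination -h

theorem phase_sub_ne_zero : 2 * phase - 2 * (cosAngle : ℂ) ≠ 0 := by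
  intro h
  have := congrArg Complex.im h
  simp at this
  exact phase_im_pos.ne' this

theorem observable_zero : observable 0 = !![0, 1; 1, 0] := by
  simp [observable]

theorem observable_alpha_one :
    observable (alpha 1) = !![0, phase; 2 * (cosAngle : ℂ) - phase, 0] := by
  rw [observable, exp_neg_alpha_one]
  rfl

theorem observable_beta_one : observable (beta 1) = -observable (alpha 1) := by
  have h : beta 1 = alpha 1 - Real.pi := by simp [alpha, beta]; ring
  have h1 : Complex.I * ((alpha 1 - Real.pi : ℝ) : ℂ) =
      Complex.I * (alpha 1 : ℂ) - Real.pi * Complex.I := by push_cast; ring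
  rw [h, observable, observable, h1, neg_sub', sub_neg_eq_add, Complex.exp_sub, Complex.exp_add, Complex.exp_pi_mul_I]
  ext i j
  fin_cases i <;> fin_cases j <;> simp [div_neg]

/-! ### Extraction of a qubit -/

/-- Two blocks on top of each other. -/
def stack {ι κ : Type*} (M0 M1 : Matrix ι κ ℂ) : Matrix (Fin 2 × ι) κ ℂ :=
  Matrix.of fun i j => ![M0, M1] i.1 i.2 j

section Stack

variable {ι κ : Type*}

theorem conjTranspose_stack_mul_stack [Fintype ι] (M0 M1 : Matrix ι κ ℂ) :
    (stack M0 M1).conjTranspose * stack M0 M1 =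
      M0.conjTranspose * M0 + M1.conjTranspose * M1 := by
  ext i j
  simp [stack, Matrix.mul_apply, Fintype.sum_prod_type]

theorem stack_mul [Fintype κ] {κ' : Type*} (M0 M1 : Matrix ι κ ℂ) (N : Matrix κ κ' ℂ) :
    stack M0 M1 * N = stack (M0 * N) (M1 * N) := by
  ext ⟨i, j⟩ k
  fin_cases i <;> simp [stack, Matrix.mul_apply]

theorem kronecker_one_mul_stack [Fintype ι] [DecidableEq ι] (X : Matrix (Fin 2) (Fin 2) ℂ)
    (M0 M1 : Matrix ι κ ℂ) :
    (X ⊗ₖ (1 : Matrix ι ι ℂ)) * stack M0 M1 =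
      stack (X 0 0 • M0 + X 0 1 • M1) (X 1 0 • M0 + X 1 1 • M1) := by
  ext ⟨i, j⟩ k
  fin_cases i <;>
    simp [stack, Matrix.mul_apply, Fintype.sum_prod_type, Matrix.one_apply]

end Stack

theorem LocalRelations.exists_isometry {m : ℕ} {a0 a1 P : Matrix (Fin m) (Fin m) ℂ}
    (h : LocalRelations a0 a1 P) :
    ∃ W : Matrix (Fin 2 × Fin m) (Fin m) ℂ, IsIsometry W ∧
      W * (a0 * P) = (observable 0 ⊗ₖ (1 : Matrix (Fin m) (Fin m) ℂ)) * (W * P) ∧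
      W * (a1 * P) = (observable (alpha 1) ⊗ₖ (1 : Matrix (Fin m) (Fin m) ℂ)) * (W * P) := by
  have he := phase_mul_phase
  have hse := star_phase
  obtain ⟨δ, hδ⟩ : ∃ δ : ℂ, δ * (2 * phase - 2 * (cosAngle : ℂ)) = 1 :=
    ⟨_, inv_mul_cancel₀ phase_sub_ne_zero⟩
  have hsδ : star δ = -δ := by
    have h1 := congrArg star hδ
    have hsc : star (cosAngle : ℂ) = cosAngle := Complex.conj_ofReal _
    rw [star_mul', star_sub, star_mul', star_mul', hse, hsc, star_one, star_ofNat] at h1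
    apply mul_right_cancel₀ phase_sub_ne_zero
    linear_combination -h1 + hδ
  have hanti : a0 * (a1 * P) = (2 * (cosAngle : ℂ)) • P - a1 * (a0 * P) := by
    rw [eq_sub_iff_add_eq, h.anticomm, ← Complex.coe_smul]
    push_cast
    rfl
  rw [observable_zero, observable_alpha_one]
  generalize phase = e at *
  generalize (cosAngle : ℂ) = c at *
  have c0 := h.comm0.symm
  have c1 := h.comm1.symm
  have k0 : ∀ X, P * (a0 * X) = a0 * (P * X) := fun X => by
    rw [← Matrix.mul_assoc, c0, Matrix.mul_assoc]
  have k1 : ∀ X, P * (a1 * X) = a1 * (P * X) := fun X => by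
    rw [← Matrix.mul_assoc, c1, Matrix.mul_assoc]
  have w0 : a1 * (a1 * (a0 * P)) = a0 * P := by
    have := congrArg (· * a0) h.sq1
    simpa only [Matrix.mul_assoc, c0] using this
  have w1 : a0 * (a1 * (a0 * P)) = (2 * c) • (a0 * P) - a1 * P := by
    have := congrArg (· * a0) hanti
    simpa only [Matrix.mul_assoc, Matrix.sub_mul, Matrix.smul_mul, c0, h.sq0] using this
  -- On the range of P the unitary u = a1 a0 satisfies u + u† = 2c, so its eigenvalues are e and its
  -- conjugate. Then π projects onto the eigenspace of the conjugate of e, and a0, which maps u to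
  -- u† by conjugation, exchanges the two eigenspaces.
  let π := δ • (e • P - a1 * (a0 * P))
  have hπ : π = δ • (e • P - a1 * (a0 * P)) := rfl
  have hherm : π.conjTranspose = π := by
    simp only [hπ, Matrix.conjTranspose_smul, Matrix.conjTranspose_sub, Matrix.conjTranspose_mul,
      h.herm0, h.herm1, h.hermP, hsδ, hse, c0, c1, Matrix.mul_assoc, hanti]
    module
  have hidem : π * π = π := by
    simp only [hπ, Matrix.smul_mul, Matrix.mul_smul, Matrix.sub_mul, Matrix.mul_sub,
      Matrix.mul_assoc, k0, k1, h.idem, w1, h.sq1, smul_sub, smul_smul]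
    match_scalars <;> grind
  have hsq : a0 * (a0 * π) = π := by
    simp only [hπ, Matrix.mul_smul, Matrix.mul_sub, w1, h.sq0, hanti]
    module
  -- The range of π is labelled by the second basis vector after a0 has moved it to the other
  -- eigenspace. Everything else, including the complement of the range of P, is labelled by the
  -- first, so W is an isometry on the whole space.
  refine ⟨stack (1 - π) (a0 * π), ?_, ?_, ?_⟩
  · rw [IsIsometry, conjTranspose_stack_mul_stack, Matrix.conjTranspose_sub,
      Matrix.conjTranspose_mul, hherm, h.herm0, Matrix.conjTranspose_one, Matrix.mul_assoc, hsq,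
      sub_mul, one_mul, mul_sub, mul_one, hidem, sub_self, sub_zero, sub_add_cancel]
  all_goals
    rw [stack_mul, stack_mul, kronecker_one_mul_stack]
    congr 1
  all_goals
    simp only [hπ, Matrix.smul_mul, Matrix.mul_smul, Matrix.sub_mul, Matrix.mul_sub,
      Matrix.mul_assoc, k0, k1, h.idem, hanti, w0, w1, h.sq0, h.sq1, smul_sub, smul_smul,
      Matrix.one_mul]
    simp
    match_scalars <;> grind

/-! ### The qubit strategy -/

theorem conjTranspose_observable (θ : ℝ) : (observable θ).conjTranspose = observable θ := by
  ext i j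
  fin_cases i <;> fin_cases j <;> simp [observable, ← Complex.exp_conj]

theorem observable_mul_self (θ : ℝ) : observable θ * observable θ = 1 := by
  ext i j
  fin_cases i <;> fin_cases j <;> simp [observable, Matrix.mul_apply, ← Complex.exp_add]

theorem obs_projector (θ : ℝ) : obs (projector θ) = observable θ := by
  simp only [obs, projector, Fin.val_zero, Fin.val_one, pow_zero, pow_one]
  module

theorem isPOVM_projector (θ : ℝ) : IsPOVM (projector θ) := by
  constructor
  · intro a
    have h : projector θ a = (projector θ a).conjTranspose * projector θ a := by
      fin_cases a <;>
        simp only [projector, Matrix.conjTranspose_smul, Matrix.conjTranspose_add,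
          Matrix.conjTranspose_one, conjTranspose_observable, mul_add, add_mul, smul_mul_assoc,
          mul_smul_comm, observable_mul_self, mul_one, one_mul] <;>
        simp <;> module
    rw [h]
    exact Matrix.posSemidef_conjTranspose_mul_self _
  · simp only [Fin.sum_univ_two, projector, Fin.val_zero, Fin.val_one, pow_zero, pow_one]
    module

/-- The Bell polynomial at the qubit observables. -/
def qubitBell : Matrix (Fin 2 × Fin 2) (Fin 2 × Fin 2) ℂ :=
  bellPoly (observable 0 ⊗ₖ 1) (observable (alpha 1) ⊗ₖ 1) (1 ⊗ₖ observable (alpha 1))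
    (1 ⊗ₖ observable 0)

theorem alpha_zero : alpha 0 = 0 := rfl

theorem beta_zero : beta 0 = 0 := rfl

theorem bell_qubitStrategy (ψ : Fin 2 × Fin 2 → ℂ) : (qubitStrategy ψ).bell = qubitBell := by
  have h : -((1 : Matrix (Fin 2) (Fin 2) ℂ) ⊗ₖ (-observable (alpha 1))) =
      1 ⊗ₖ observable (alpha 1) := by ext; simp
  simp only [Strategy.bell, Strategy.opA, Strategy.opB, qubitStrategy, qubitBell, obs_projector,
    observable_beta_one, alpha_zero, beta_zero, h]

theorem isQuantum_qubitStrategy {ψ : Fin 2 × Fin 2 → ℂ} (hψ : star ψ ⬝ᵥ ψ = 1) :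
    (qubitStrategy ψ).IsQuantum where
  state := ⟨Matrix.posSemidef_vecMulVec_self_star ψ, by
    rw [qubitStrategy, Matrix.trace_vecMulVec, dotProduct_comm, hψ]⟩
  alice _ := isPOVM_projector _
  bob _ := isPOVM_projector _

theorem bellOperator_eq :
    bellOperator = (1 / 16 : ℂ) • ((5 : ℂ) • (1 : Matrix (Fin 2 × Fin 2) (Fin 2 × Fin 2) ℂ)
      + qubitBell) := by
  have hA := fun x => (isPOVM_projector (alpha x)).eq_one_sub
  have hB := fun y => (isPOVM_projector (beta y)).eq_one_sub
  have h : (1 : Matrix (Fin 2) (Fin 2) ℂ) ⊗ₖ observable (alpha 1) =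
      -(1 ⊗ₖ observable (beta 1)) := by rw [observable_beta_one]; ext; simp
  rw [qubitBell, h, ← alpha_zero]
  nth_rewrite 2 [alpha_zero]
  rw [← beta_zero]
  simp only [bellOperator, bellPoly, mul_neg, kronecker_one_mul_one_kronecker, Fin.sum_univ_two, V]
  simp only [← obs_projector]
  simp only [obs, hA, hB, sub_kronecker, kronecker_sub, Matrix.one_kronecker_one,
    ← Complex.coe_smul]
  norm_num
  module

theorem qubitBell_mulVec (φ : Fin 2 × Fin 2 → ℂ) :
    qubitBell.mulVec φ (0, 0) =
      φ (0, 1) + (phase * φ (1, 0) + (phase + 1 + phase * phase - 2 * phase) * φ (1, 1)) ∧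
    qubitBell.mulVec φ (0, 1) =
      φ (0, 0) + ((2 * cosAngle - phase + 1 + phase * (2 * cosAngle - phase) - 2 * phase) *
        φ (1, 0) + phase * φ (1, 1)) ∧
    qubitBell.mulVec φ (1, 0) =
      (2 * cosAngle - phase) * φ (0, 0) + (phase + 1 + (2 * cosAngle - phase) * phase -
        2 * (2 * cosAngle - phase)) * φ (0, 1) + φ (1, 1) ∧
    qubitBell.mulVec φ (1, 1) =
      (2 * cosAngle - phase + 1 + (2 * cosAngle - phase) * (2 * cosAngle - phase) -
        2 * (2 * cosAngle - phase)) * φ (0, 0) + (2 * cosAngle - phase) * φ (0, 1) + φ (1, 0) := by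
  rw [qubitBell, bellPoly]
  simp only [kronecker_one_mul_one_kronecker, observable_zero, observable_alpha_one]
  refine ⟨?_, ?_, ?_, ?_⟩ <;>
    simp [Matrix.mulVec, dotProduct, Fintype.sum_prod_type, Matrix.one_apply]

/-- The top eigenvector of the Bell operator, not normalized. -/
def topVector : Fin 2 × Fin 2 → ℂ := fun i =>
  !![phase, (9 + 3 * (√13 : ℝ)) / 2 + (5 + (√13 : ℝ)) / 2 * phase;
    (5 + (√13 : ℝ)) / 2 + (9 + 3 * (√13 : ℝ)) / 2 * phase, 1] i.1 i.2

theorem sq_sqrt_thirteen_complex : ((√13 : ℝ) : ℂ) * ((√13 : ℝ) : ℂ) = 13 := by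
  exact_mod_cast congrArg (fun x : ℝ => (x : ℂ)) sq_sqrt_thirteen

theorem ofReal_cosAngle : (cosAngle : ℂ) = (2 - (√13 : ℝ)) / 9 := by
  simp [cosAngle]

theorem ofReal_bellMax : (bellMax : ℂ) = (19 + 4 * (√13 : ℝ)) / 9 := by
  simp [bellMax]

theorem qubitBell_mulVec_topVector : qubitBell.mulVec topVector = (bellMax : ℂ) • topVector := by
  obtain ⟨h0, h1, h2, h3⟩ := qubitBell_mulVec topVector
  have he := phase_mul_phase
  have hr := sq_sqrt_thirteen_complex
  ext ⟨i, j⟩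
  fin_cases i <;> fin_cases j
  on_goal 1 => refine h0.trans ?_
  on_goal 2 => refine h1.trans ?_
  on_goal 3 => refine h2.trans ?_
  on_goal 4 => refine h3.trans ?_
  all_goals
    simp [topVector, ofReal_bellMax]
    rw [ofReal_cosAngle] at *
    generalize ((√13 : ℝ) : ℂ) = r at *
    clear h0 h1 h2 h3
    grind

/-- Nondegeneracy of the eigenvalue: the multipliers below solve the four eigenvalue equations for
three coordinates in terms of the last. -/
theorem eq_smul_topVector {φ : Fin 2 × Fin 2 → ℂ}
    (hφ : qubitBell.mulVec φ = (bellMax : ℂ) • φ) : φ = φ (1, 1) • topVector := by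
  obtain ⟨h0, h1, h2, h3⟩ := qubitBell_mulVec φ
  have he := phase_mul_phase
  have hr := sq_sqrt_thirteen_complex
  simp only [hφ, Pi.smul_apply, smul_eq_mul, ofReal_bellMax] at h0 h1 h2 h3
  rw [ofReal_cosAngle] at *
  have e0 : φ (0, 0) = φ (1, 1) * topVector (0, 0) := by
    simp only [topVector, Matrix.of_apply, Matrix.cons_val]
    generalize ((√13 : ℝ) : ℂ) = r at *
    linear_combination (norm := skip) (7 - r) / 8 * (h0 - phase * h3)
    clear h0 h1 h2 h3 hφ
    grind
  have e1 : φ (0, 1) = φ (1, 1) * topVector (0, 1) := by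
    simp only [topVector, Matrix.of_apply, Matrix.cons_val]
    generalize ((√13 : ℝ) : ℂ) = r at *
    linear_combination (norm := skip) (-(43 + 11 * r) / 8) * h1 +
      (-3 - 3 * r / 4 + (17 / 4 + r) * phase) * h2 +
      (-3 / 2 - 3 * r / 4 - (11 / 8 + r / 8) * phase) * h3
    clear h0 h1 h2 h3 hφ
    grind
  have e2 : φ (1, 0) = φ (1, 1) * topVector (1, 0) := by
    simp only [topVector, Matrix.of_apply, Matrix.cons_val]
    generalize ((√13 : ℝ) : ℂ) = r at *
    linear_combination (norm := skip) (-4 - 5 * r / 4 - (17 / 4 + r) * phase) * h1 +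
      (-(43 + 11 * r) / 8) * h2 + (-11 / 8 - r / 8 - (3 / 2 + 3 * r / 4) * phase) * h3
    clear h0 h1 h2 h3 hφ
    grind
  ext ⟨i, j⟩
  fin_cases i <;> fin_cases j
  · exact e0
  · exact e1
  · exact e2
  · simp [topVector]

theorem star_topVector_dotProduct : star topVector ⬝ᵥ topVector = ((104 + 28 * √13 : ℝ) : ℂ) := by
  have he := phase_mul_phase
  have hr := sq_sqrt_thirteen_complex
  have hs : (starRingEnd ℂ) phase = 2 * (cosAngle : ℂ) - phase := star_phase
  simp [dotProduct, Fintype.sum_prod_type, topVector, hs, map_ofNat]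
  rw [ofReal_cosAngle] at *
  generalize ((√13 : ℝ) : ℂ) = r at *
  grind

/-- The top eigenvector of the Bell operator. -/
def topState : Fin 2 × Fin 2 → ℂ := (((√(104 + 28 * √13))⁻¹ : ℝ) : ℂ) • topVector

theorem star_topState_dotProduct : star topState ⬝ᵥ topState = 1 := by
  have h : (0 : ℝ) < 104 + 28 * √13 := by positivity
  rw [topState, star_smul, smul_dotProduct, dotProduct_smul, star_topVector_dotProduct]
  simp only [smul_eq_mul, Complex.star_def, Complex.conj_ofReal, ← Complex.ofReal_mul]
  rw [← Complex.ofReal_one]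
  congr 1
  have h1 := Real.sqrt_pos.2 h
  have h2 := Real.mul_self_sqrt h.le
  field_simp
  linarith

theorem topState_ne_zero : topState (1, 1) ≠ 0 := by
  have h : √(104 + 28 * √13) ≠ 0 := by positivity
  simpa [topState, topVector] using h

theorem qubitBell_mulVec_topState : qubitBell.mulVec topState = (bellMax : ℂ) • topState := by
  rw [topState, Matrix.mulVec_smul, qubitBell_mulVec_topVector, smul_comm]

theorem eq_smul_topState {φ : Fin 2 × Fin 2 → ℂ}
    (hφ : qubitBell.mulVec φ = (bellMax : ℂ) • φ) : ∃ c : ℂ, φ = c • topState := by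
  have h : ((√(104 + 28 * √13) : ℝ) : ℂ) ≠ 0 := by
    have : √(104 + 28 * √13) ≠ 0 := by positivity
    exact_mod_cast this
  refine ⟨φ (1, 1) * ((√(104 + 28 * √13) : ℝ) : ℂ), ?_⟩
  rw [topState, smul_smul, Complex.ofReal_inv, mul_assoc, mul_inv_cancel₀ h, mul_one]
  exact eq_smul_topVector hφ

theorem expect_vecMulVec_of_mulVec_eq {ι : Type*} [Fintype ι] {M : Matrix ι ι ℂ} {φ : ι → ℂ} {s : ℝ}
    (h : M.mulVec φ = (s : ℂ) • φ) :
    expect (Matrix.vecMulVec φ (star φ)) M = s * (star φ ⬝ᵥ φ).re := by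
  rw [expect_apply, Matrix.trace_mul_comm, Matrix.mul_vecMulVec, h, Matrix.trace_vecMulVec,
    smul_dotProduct, smul_eq_mul, Complex.re_ofReal_mul, dotProduct_comm]

theorem value_qubitStrategy_topState : (qubitStrategy topState).value = omegaQ := by
  rw [(isQuantum_qubitStrategy star_topState_dotProduct).value_eq, bell_qubitStrategy]
  have h := expect_vecMulVec_of_mulVec_eq qubitBell_mulVec_topState
  rw [star_topState_dotProduct, Complex.one_re, mul_one] at h
  rw [qubitStrategy, h, bellMax, omegaQ]
  ring

/-! ### Optimality and the largest eigenvalue -/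

theorem isOptimal_iff {m n : ℕ} {S : Strategy m n} :
    S.IsOptimal ↔ S.IsQuantum ∧ S.value = omegaQ := by
  constructor
  · rintro ⟨h, hmax⟩
    refine ⟨h, le_antisymm h.value_le ?_⟩
    rw [← value_qubitStrategy_topState]
    exact hmax _ _ _ (isQuantum_qubitStrategy star_topState_dotProduct)
  · rintro ⟨h, hv⟩
    exact ⟨h, fun _ _ T hT => hv ▸ hT.value_le⟩

theorem bellOperator_mulVec_iff (φ : Fin 2 × Fin 2 → ℂ) (s : ℝ) :
    bellOperator.mulVec φ = (s : ℂ) • φ ↔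
      qubitBell.mulVec φ = ((16 * s - 5 : ℝ) : ℂ) • φ := by
  rw [bellOperator_eq, Matrix.smul_mulVec, Matrix.add_mulVec, Matrix.smul_mulVec,
    Matrix.one_mulVec]
  constructor
  · intro h
    have h' : qubitBell.mulVec φ =
        (16 : ℂ) • ((1 / 16 : ℂ) • ((5 : ℂ) • φ + qubitBell.mulVec φ)) - (5 : ℂ) • φ := by module
    rw [h', h]
    push_cast
    module
  · intro h
    rw [h]
    push_cast
    module

theorem le_bellMax_of_mulVec_eq {φ : Fin 2 × Fin 2 → ℂ} (hφ : φ ≠ 0) {s : ℝ}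
    (h : qubitBell.mulVec φ = (s : ℂ) • φ) : s ≤ bellMax := by
  -- The operator bound holds for every positive matrix, so it is applied to the unnormalized
  -- projector of φ; `topState` only serves to name a strategy with these observables.
  have hc := (isQuantum_qubitStrategy star_topState_dotProduct).contractions
  have h0 := hc.expect_bellMax_sub_nonneg (Matrix.posSemidef_vecMulVec_self_star φ)
  have hb := bell_qubitStrategy topState
  rw [Strategy.bell] at hb
  have h1 := expect_vecMulVec_of_mulVec_eq (M := 1) (φ := φ) (s := 1) (by simp)
  rw [hb, map_sub, map_smul, expect_vecMulVec_of_mulVec_eq h, h1, one_mul, smul_eq_mul,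
    ← sub_mul] at h0
  have hpos : 0 < (star φ ⬝ᵥ φ).re := by
    have := (Complex.lt_def.1 (Matrix.dotProduct_star_self_pos_iff.2 hφ)).1
    simpa using this
  nlinarith [nonneg_of_mul_nonneg_left h0 hpos]

theorem isTopEigenvector_topState : IsTopEigenvector topState := by
  refine ⟨star_topState_dotProduct, omegaQ, ?_, fun s φ hφ hs => ?_⟩
  · rw [bellOperator_mulVec_iff]
    convert qubitBell_mulVec_topState using 3
    rw [omegaQ, bellMax]
    ring
  · have := le_bellMax_of_mulVec_eq hφ ((bellOperator_mulVec_iff φ s).1 hs)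
    rw [bellMax] at this
    rw [omegaQ]
    linarith

theorem eq_smul_of_isTopEigenvector {φ : Fin 2 × Fin 2 → ℂ} (hφ : IsTopEigenvector φ) :
    ∃ c : ℂ, ‖c‖ = 1 ∧ φ = c • topState := by
  obtain ⟨hn, s, hs, hmax⟩ := hφ
  have hne : topState ≠ 0 := fun h => topState_ne_zero (by rw [h]; rfl)
  have hφ0 : φ ≠ 0 := fun h => by simp [h] at hn
  have h1 := hmax omegaQ topState hne (by
    rw [bellOperator_mulVec_iff]
    convert qubitBell_mulVec_topState using 3
    rw [omegaQ, bellMax]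
    ring)
  rw [bellOperator_mulVec_iff] at hs
  have h2 := le_bellMax_of_mulVec_eq hφ0 hs
  have h3 : 16 * s - 5 = bellMax := by
    refine le_antisymm h2 ?_
    rw [omegaQ] at h1
    rw [bellMax]
    linarith
  rw [h3] at hs
  obtain ⟨c, rfl⟩ := eq_smul_topState hs
  refine ⟨c, ?_, rfl⟩
  rw [star_smul, smul_dotProduct, dotProduct_smul, star_topState_dotProduct, smul_eq_mul,
    smul_eq_mul, mul_one, Complex.star_def, ← Complex.normSq_eq_conj_mul_self] at hn
  have : Complex.normSq c = 1 := by exact_mod_cast hn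
  rw [← Complex.sq_norm] at this
  nlinarith [norm_nonneg c]

/-! ### Positivity of the optimal probabilities -/

theorem ofReal_add_mul_phase_ne_zero {A B : ℝ} (h : A ≠ 0 ∨ B ≠ 0) :
    (A : ℂ) + B * phase ≠ 0 := by
  intro h0
  have hB : B = 0 := by
    have := congrArg Complex.im h0
    simp [phase_im_pos.ne'] at this
    exact this
  subst hB
  have hA : A = 0 := by simpa using h0
  subst hA
  simp at h

theorem projector_one_apply (θ : ℝ) (a : Fin 2) :
    projector θ a 1 0 = 1 / 2 * ((-1) ^ (a : ℕ) * observable θ 1 0) ∧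
      projector θ a 1 1 = 1 / 2 := by
  simp [projector, observable]

/-- Reduced by the quadratic equation of `phase`, four times the coordinate has the form A + B ·
`phase` with A, B real. Since `phase` is not real, one nonzero coefficient suffices, for each choice
of the signs s, t. -/
theorem projector_mulVec_topVector_ne_zero (x a y b : Fin 2) :
    (projector (alpha x) a ⊗ₖ projector (beta y) b).mulVec topVector (1, 1) ≠ 0 := by
  have hr := sq_sqrt_thirteen
  have he := phase_mul_phase
  have hr' := sq_sqrt_thirteen_complex
  have b1 := sqrt_thirteen_gt
  have b2 := sqrt_thirteen_lt
  obtain ⟨s, hs, hs'⟩ : ∃ s : ℝ, (s = 1 ∨ s = -1) ∧ (-1 : ℂ) ^ (a : ℕ) = s := by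
    fin_cases a
    · exact ⟨1, .inl rfl, by simp⟩
    · exact ⟨-1, .inr rfl, by simp⟩
  obtain ⟨t, ht, ht'⟩ : ∃ t : ℝ, (t = 1 ∨ t = -1) ∧ (-1 : ℂ) ^ (b : ℕ) = t := by
    fin_cases b
    · exact ⟨1, .inl rfl, by simp⟩
    · exact ⟨-1, .inr rfl, by simp⟩
  have hexp : (projector (alpha x) a ⊗ₖ projector (beta y) b).mulVec topVector (1, 1) =
      1 / 4 * (s * t * (observable (alpha x) 1 0 * observable (beta y) 1 0) * phase +
        s * observable (alpha x) 1 0 *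
          ((9 + 3 * (√13 : ℝ)) / 2 + (5 + (√13 : ℝ)) / 2 * phase) +
        t * observable (beta y) 1 0 *
          ((5 + (√13 : ℝ)) / 2 + (9 + 3 * (√13 : ℝ)) / 2 * phase) + 1) := by
    simp [Matrix.mulVec, dotProduct, Fintype.sum_prod_type, topVector, projector_one_apply, hs',
      ht']
    ring
  rw [hexp]
  refine mul_ne_zero (by norm_num) ?_
  fin_cases x <;> fin_cases y <;>
    simp only [Fin.zero_eta, Fin.mk_one, alpha_zero, beta_zero, observable_beta_one,
      observable_zero, observable_alpha_one, Matrix.neg_apply, Matrix.of_apply, Matrix.cons_val]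
  · have h := ofReal_add_mul_phase_ne_zero (A := 1 + s * ((9 + 3 * √13) / 2) + t * ((5 + √13) / 2))
      (B := s * t + s * ((5 + √13) / 2) + t * ((9 + 3 * √13) / 2)) (Or.inr (by
        rcases hs with rfl | rfl <;> rcases ht with rfl | rfl <;> intro h0 <;> linarith))
    convert h using 1
    push_cast
    ring
  · have h := ofReal_add_mul_phase_ne_zero (A := 1 - s * t + s * ((9 + 3 * √13) / 2) -
        t * (2 * cosAngle * ((5 + √13) / 2) + (9 + 3 * √13) / 2))
      (B := s * ((5 + √13) / 2) + t * ((5 + √13) / 2)) (Or.inl (by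
        rw [cosAngle]
        rcases hs with rfl | rfl <;> rcases ht with rfl | rfl <;> intro h0 <;> linarith))
    convert h using 1
    push_cast
    linear_combination (s * t + t * ((9 + 3 * (√13 : ℝ)) / 2)) * he
  · have h := ofReal_add_mul_phase_ne_zero (A := 1 + s * t +
        s * (2 * cosAngle * ((9 + 3 * √13) / 2) + (5 + √13) / 2) + t * ((5 + √13) / 2))
      (B := - s * ((9 + 3 * √13) / 2) + t * ((9 + 3 * √13) / 2)) (Or.inl (by
        rw [cosAngle]
        rcases hs with rfl | rfl <;> rcases ht with rfl | rfl <;> intro h0 <;> linarith))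
    convert h using 1
    push_cast
    linear_combination (-s * t - s * ((5 + (√13 : ℝ)) / 2)) * he
  · have h := ofReal_add_mul_phase_ne_zero (A := 1 - 2 * cosAngle * s * t +
        s * (2 * cosAngle * ((9 + 3 * √13) / 2) + (5 + √13) / 2) -
        t * (2 * cosAngle * ((5 + √13) / 2) + (9 + 3 * √13) / 2))
      (B := s * t - s * ((9 + 3 * √13) / 2) + t * ((5 + √13) / 2)) (Or.inl (by
        rw [cosAngle]
        rcases hs with rfl | rfl <;> rcases ht with rfl | rfl <;> intro h0 <;> linarith))
    convert h using 1
    push_cast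
    linear_combination (s * t * (2 * cosAngle - phase) - s * ((5 + (√13 : ℝ)) / 2) +
      t * ((9 + 3 * (√13 : ℝ)) / 2)) * he

theorem box_qubitStrategy_pos (a b x y : Fin 2) : 0 < (qubitStrategy topState).box a b x y := by
  have hq := isQuantum_qubitStrategy star_topState_dotProduct
  have hM : (projector (alpha x) a ⊗ₖ projector (beta y) b).PosSemidef :=
    ((isPOVM_projector _).1 a).kronecker ((isPOVM_projector _).1 b)
  refine lt_of_le_of_ne (expect_nonneg hq.state.1 hM) fun h0 => ?_
  have h1 := mul_eq_zero_of_posSemidef hq.state.1 hM h0.symm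
  have h2 := congrFun (congrFun h1 (1, 1)) (1, 1)
  simp only [qubitStrategy, Matrix.mul_vecMulVec, Matrix.vecMulVec_apply, Matrix.zero_apply,
    Pi.star_apply, mul_eq_zero, star_eq_zero, topState_ne_zero, or_false] at h2
  rw [topState, Matrix.mulVec_smul, Pi.smul_apply, smul_eq_mul, mul_eq_zero] at h2
  refine h2.elim (fun h3 => ?_) (projector_mulVec_topVector_ne_zero x a y b)
  have h : √(104 + 28 * √13) ≠ 0 := by positivity
  simp [h] at h3

/-! ### Self-testing -/

section Ancilla

variable {m n : ℕ}

/-- The reordering of the tensor factors. -/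
abbrev reorder (m n : ℕ) :
    (Fin 2 × Fin m) × (Fin 2 × Fin n) ≃ (Fin 2 × Fin 2) × (Fin m × Fin n) :=
  Equiv.prodProdProdComm (Fin 2) (Fin m) (Fin 2) (Fin n)

theorem kronecker_kronecker_eq_submatrix (X Y : Matrix (Fin 2) (Fin 2) ℂ) :
    (X ⊗ₖ (1 : Matrix (Fin m) (Fin m) ℂ)) ⊗ₖ (Y ⊗ₖ (1 : Matrix (Fin n) (Fin n) ℂ)) =
      ((X ⊗ₖ Y) ⊗ₖ (1 : Matrix (Fin m × Fin n) (Fin m × Fin n) ℂ)).submatrix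
        (reorder m n) (reorder m n) := by
  ext ⟨⟨i, k⟩, ⟨j, l⟩⟩ ⟨⟨i', k'⟩, ⟨j', l'⟩⟩
  by_cases hk : k = k' <;> by_cases hl : l = l' <;>
    simp [Prod.ext_iff, hk, hl]

theorem kronecker_kronecker_mul_apply {ζ : Type*} (X Y : Matrix (Fin 2) (Fin 2) ℂ)
    (M : Matrix ((Fin 2 × Fin m) × (Fin 2 × Fin n)) ζ ℂ) (i j : Fin 2) (k : Fin m) (l : Fin n)
    (z : ζ) :
    (((X ⊗ₖ (1 : Matrix (Fin m) (Fin m) ℂ)) ⊗ₖ (Y ⊗ₖ (1 : Matrix (Fin n) (Fin n) ℂ))) * M)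
        ((i, k), (j, l)) z =
      (X ⊗ₖ Y).mulVec (fun u => M ((u.1, k), (u.2, l)) z) (i, j) := by
  simp only [Matrix.mul_apply, Fintype.sum_prod_type, Matrix.kroneckerMap_apply, Matrix.one_apply,
    Matrix.mulVec, dotProduct, Fin.sum_univ_two]
  simp [Finset.sum_add_distrib]

/-- The isometry that adjoins the state vector `ψ`. -/
def adjoin (m n : ℕ) (ψ : Fin 2 × Fin 2 → ℂ) :
    Matrix ((Fin 2 × Fin m) × (Fin 2 × Fin n)) (Fin m × Fin n) ℂ :=
  Matrix.of fun u w => ψ (u.1.1, u.2.1) * (if u.1.2 = w.1 ∧ u.2.2 = w.2 then 1 else 0)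

theorem adjoin_mul_mul_conjTranspose (ψ : Fin 2 × Fin 2 → ℂ)
    (σ : Matrix (Fin m × Fin n) (Fin m × Fin n) ℂ) :
    adjoin m n ψ * σ * (adjoin m n ψ).conjTranspose =
      (Matrix.vecMulVec ψ (star ψ) ⊗ₖ σ).submatrix (reorder m n) (reorder m n) := by
  ext ⟨⟨i, k⟩, ⟨j, l⟩⟩ ⟨⟨i', k'⟩, ⟨j', l'⟩⟩
  simp [adjoin, Matrix.mul_apply, Fintype.sum_prod_type, ite_and, Matrix.vecMulVec_apply,
    apply_ite (starRingEnd ℂ)]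
  ring

/-- C C† is the projection |ψ⟩⟨ψ| ⊗ 1, which fixes every matrix whose qubit slices are multiples of
ψ. -/
theorem adjoin_mul_conjTranspose_mul_eq {ψ : Fin 2 × Fin 2 → ℂ} (hψ : star ψ ⬝ᵥ ψ = 1) {ζ : Type*}
    {M : Matrix ((Fin 2 × Fin m) × (Fin 2 × Fin n)) ζ ℂ}
    (h : ∀ k l z, ∃ c : ℂ, (fun u : Fin 2 × Fin 2 => M ((u.1, k), (u.2, l)) z) = c • ψ) :
    adjoin m n ψ * ((adjoin m n ψ).conjTranspose * M) = M := by
  ext ⟨⟨i, k⟩, ⟨j, l⟩⟩ z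
  obtain ⟨c, hc⟩ := h k l z
  have hu : ∀ i j, M ((i, k), (j, l)) z = c * ψ (i, j) := fun i j => congrFun hc (i, j)
  rw [hu, ← mul_one (c * _), ← hψ]
  simp [adjoin, Matrix.mul_apply, Fintype.sum_prod_type, ite_and, dotProduct, hu,
    apply_ite (starRingEnd ℂ), Finset.sum_add_distrib]
  ring

end Ancilla

theorem kronecker_mul_kronecker_mul {m n : ℕ} {ι κ : Type*} [Fintype ι] [Fintype κ]
    {ρ : Matrix (Fin m × Fin n) (Fin m × Fin n) ℂ} {PA MA : Matrix (Fin m) (Fin m) ℂ}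
    {PB MB : Matrix (Fin n) (Fin n) ℂ} {WA : Matrix ι (Fin m) ℂ} {WB : Matrix κ (Fin n) ℂ}
    {NA : Matrix ι ι ℂ} {NB : Matrix κ κ ℂ} (hρ : (PA ⊗ₖ PB) * ρ = ρ)
    (hA : WA * (MA * PA) = NA * (WA * PA)) (hB : WB * (MB * PB) = NB * (WB * PB)) :
    (WA ⊗ₖ WB) * ((MA ⊗ₖ MB) * ρ) = (NA ⊗ₖ NB) * ((WA ⊗ₖ WB) * ρ) := by
  conv_lhs => rw [← hρ]
  conv_rhs => rw [← hρ]
  simp only [← Matrix.mul_assoc, ← Matrix.mul_kronecker_mul]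
  rw [Matrix.mul_assoc WA, Matrix.mul_assoc WB, hA, hB, Matrix.mul_assoc NA, Matrix.mul_assoc NB]

theorem mul_projector_of_observable {m : ℕ} {M : Fin 2 → Matrix (Fin m) (Fin m) ℂ}
    (hM : IsPOVM M) {P : Matrix (Fin m) (Fin m) ℂ} {W : Matrix (Fin 2 × Fin m) (Fin m) ℂ} {θ : ℝ}
    (h : W * (obs M * P) = (observable θ ⊗ₖ (1 : Matrix (Fin m) (Fin m) ℂ)) * (W * P))
    (a : Fin 2) :
    W * (M a * P) = (projector θ a ⊗ₖ (1 : Matrix (Fin m) (Fin m) ℂ)) * (W * P) := by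
  rw [hM.eq_obs a, projector, Matrix.smul_kronecker, Matrix.add_kronecker, Matrix.smul_kronecker,
    Matrix.one_kronecker_one]
  simp only [Matrix.smul_mul, Matrix.mul_smul, Matrix.add_mul, Matrix.mul_add, Matrix.one_mul, h]

theorem equivUpToLocalIsometry_of_isOptimal {m n : ℕ} {S : Strategy m n} (hS : S.IsOptimal) :
    S.EquivUpToLocalIsometry (qubitStrategy topState) := by
  obtain ⟨hq, hv⟩ := isOptimal_iff.1 hS
  have hneg : -S.opB 1 = (1 : Matrix (Fin m) (Fin m) ℂ) ⊗ₖ (-obs (S.B 1)) := by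
    ext; simp [Strategy.opB]
  have hrel := hq.optimalRelations hv
  rw [hneg] at hrel
  obtain ⟨PA, hPA, hPAρ⟩ := hrel.exists_localRelations hq.state.1 (hq.alice 0).conjTranspose_obs
    (hq.alice 1).conjTranspose_obs
  obtain ⟨PB, hPB, hPBρ⟩ := hrel.exists_localRelations_right hq.state.1
    (by rw [Matrix.conjTranspose_neg, (hq.bob 1).conjTranspose_obs])
    (hq.bob 0).conjTranspose_obs
  obtain ⟨WA, hWA, hA0, hA1⟩ := hPA.exists_isometry
  -- The pair is swapped because q1 = b₀ is the observable at angle 0 and q0 = -b₁ the one at angle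
  -- `alpha 1`.
  obtain ⟨WB, hWB, hB0, hB1⟩ := hPB.symm.exists_isometry
  have hPρ : (PA ⊗ₖ PB) * S.ρ = S.ρ := by
    rw [← kronecker_one_mul_one_kronecker, Matrix.mul_assoc, hPBρ, hPAρ]
  have hB1' : WB * (obs (S.B 1) * PB) =
      (observable (beta 1) ⊗ₖ (1 : Matrix (Fin n) (Fin n) ℂ)) * (WB * PB) := by
    have hk : observable (beta 1) ⊗ₖ (1 : Matrix (Fin n) (Fin n) ℂ) =
        -(observable (alpha 1) ⊗ₖ 1) := by rw [observable_beta_one]; ext; simp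
    rw [hk, Matrix.neg_mul, ← hB1, Matrix.neg_mul, Matrix.mul_neg, neg_neg]
  have hA : ∀ x a, WA * (S.A x a * PA) =
      (projector (alpha x) a ⊗ₖ (1 : Matrix (Fin m) (Fin m) ℂ)) * (WA * PA) := by
    intro x
    refine mul_projector_of_observable (hq.alice x) ?_
    fin_cases x
    · exact hA0
    · exact hA1
  have hB : ∀ y b, WB * (S.B y b * PB) =
      (projector (beta y) b ⊗ₖ (1 : Matrix (Fin n) (Fin n) ℂ)) * (WB * PB) := by
    intro y
    refine mul_projector_of_observable (hq.bob y) ?_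
    fin_cases y
    · exact hB0
    · exact hB1'
  have h1A : WA * ((1 : Matrix (Fin m) (Fin m) ℂ) * PA) =
      ((1 : Matrix (Fin 2) (Fin 2) ℂ) ⊗ₖ (1 : Matrix (Fin m) (Fin m) ℂ)) * (WA * PA) := by
    rw [Matrix.one_kronecker_one, Matrix.one_mul, Matrix.one_mul]
  have h1B : WB * ((1 : Matrix (Fin n) (Fin n) ℂ) * PB) =
      ((1 : Matrix (Fin 2) (Fin 2) ℂ) ⊗ₖ (1 : Matrix (Fin n) (Fin n) ℂ)) * (WB * PB) := by
    rw [Matrix.one_kronecker_one, Matrix.one_mul, Matrix.one_mul]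
  have hbell : (WA ⊗ₖ WB) * (S.bell * S.ρ) = (bellMax : ℂ) • ((WA ⊗ₖ WB) * S.ρ) := by
    have := hrel.bellPoly_mul
    rw [Strategy.bell, hneg, this, Matrix.mul_smul, Complex.coe_smul]
  -- The isometries intertwine the Bell operator with `qubitBell` acting on the qubit indices alone,
  -- so each slice inherits the eigenvalue equation and nondegeneracy applies.
  have hslice : ∀ k l z, ∃ c : ℂ,
      (fun u : Fin 2 × Fin 2 => ((WA ⊗ₖ WB) * S.ρ) ((u.1, k), (u.2, l)) z) = c • topState := by
    intro k l z
    apply eq_smul_topState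
    ext ⟨i, j⟩
    have hz := congrFun (congrFun hbell ((i, k), (j, l))) z
    rw [Strategy.bell, hneg] at hz
    simp only [bellPoly, Strategy.opA, Strategy.opB, kronecker_one_mul_one_kronecker, add_mul,
      sub_mul, smul_mul_assoc, Matrix.mul_add, Matrix.mul_sub, Matrix.mul_smul,
      kronecker_mul_kronecker_mul hPρ hA1 h1B, kronecker_mul_kronecker_mul hPρ h1A hB0,
      kronecker_mul_kronecker_mul hPρ hA0 hB1, kronecker_mul_kronecker_mul hPρ hA0 hB0,
      kronecker_mul_kronecker_mul hPρ hA1 hB1, kronecker_mul_kronecker_mul hPρ hA1 hB0,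
      Matrix.add_apply, Matrix.sub_apply, Matrix.smul_apply, kronecker_kronecker_mul_apply] at hz
    simp only [qubitBell, bellPoly, kronecker_one_mul_one_kronecker, Matrix.add_mulVec,
      Matrix.sub_mulVec, Matrix.smul_mulVec, Pi.add_apply, Pi.sub_apply, Pi.smul_apply]
    exact hz
  set W := WA ⊗ₖ WB with hW
  set C := adjoin m n topState with hC
  have hCW : C * (C.conjTranspose * (W * S.ρ)) = W * S.ρ :=
    adjoin_mul_conjTranspose_mul_eq star_topState_dotProduct hslice
  have hWW : W.conjTranspose * W = 1 := by
    rw [IsIsometry] at hWA hWB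
    rw [hW, Matrix.conjTranspose_kronecker, ← Matrix.mul_kronecker_mul, hWA, hWB,
      Matrix.one_kronecker_one]
  have hCW' : S.ρ * W.conjTranspose * C * C.conjTranspose = S.ρ * W.conjTranspose := by
    have := congrArg Matrix.conjTranspose hCW
    simpa only [Matrix.conjTranspose_mul, Matrix.conjTranspose_conjTranspose,
      hq.state.1.isHermitian.eq, Matrix.mul_assoc] using this
  have hstate : W * S.ρ * W.conjTranspose =
      C * (C.conjTranspose * (W * S.ρ * W.conjTranspose) * C) * C.conjTranspose := by
    calc W * S.ρ * W.conjTranspose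
        = C * (C.conjTranspose * (W * (S.ρ * W.conjTranspose))) := by
          rw [← Matrix.mul_assoc W, ← Matrix.mul_assoc C.conjTranspose, ← Matrix.mul_assoc C, hCW]
      _ = C * (C.conjTranspose * (W * (S.ρ * W.conjTranspose * C * C.conjTranspose))) := by
          rw [hCW']
      _ = _ := by simp only [Matrix.mul_assoc]
  have hσ : IsDensity (C.conjTranspose * (W * S.ρ * W.conjTranspose) * C) := by
    refine ⟨(hq.state.1.mul_mul_conjTranspose_same W).conjTranspose_mul_mul_same C, ?_⟩
    rw [Matrix.trace_mul_comm, ← Matrix.mul_assoc C.conjTranspose, ← Matrix.mul_assoc C, hCW,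
      Matrix.trace_mul_comm, ← Matrix.mul_assoc, hWW, Matrix.one_mul, hq.state.2]
  generalize C.conjTranspose * (W * S.ρ * W.conjTranspose) * C = σ at hstate hσ
  rw [hC, adjoin_mul_mul_conjTranspose] at hstate
  refine ⟨m, n, WA, WB, σ, hWA, hWB, hσ, hstate, ?_⟩
  intro x a y b
  rw [kronecker_mul_kronecker_mul hPρ (hA x a) (hB y b), ← hW, Matrix.mul_assoc, hstate,
    kronecker_kronecker_eq_submatrix, Matrix.submatrix_mul_equiv, ← Matrix.mul_kronecker_mul,
    Matrix.one_mul]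
  rfl

/-! ### Boxes of optimal strategies -/

theorem trace_submatrix_equiv {ι κ : Type*} [Fintype ι] [Fintype κ] (e : ι ≃ κ)
    (M : Matrix κ κ ℂ) : (M.submatrix e e).trace = M.trace :=
  Equiv.sum_comp e fun k => M k k

theorem Strategy.EquivUpToLocalIsometry.box_eq {m n : ℕ} {S : Strategy m n} {R : Strategy 2 2}
    (h : S.EquivUpToLocalIsometry R) : S.box = R.box := by
  obtain ⟨k, l, WA, WB, σ, hWA, hWB, hσ, -, hM⟩ := h
  rw [IsIsometry] at hWA hWB
  have hWW : (WA ⊗ₖ WB).conjTranspose * (WA ⊗ₖ WB) = 1 := by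
    rw [Matrix.conjTranspose_kronecker, ← Matrix.mul_kronecker_mul, hWA, hWB,
      Matrix.one_kronecker_one]
  funext a b x y
  have ht := congrArg Matrix.trace (hM x a y b)
  rw [trace_submatrix_equiv, Matrix.trace_kronecker, hσ.2, mul_one, Matrix.trace_mul_comm,
    ← Matrix.mul_assoc, hWW, Matrix.one_mul] at ht
  rw [Strategy.box, Strategy.box, Matrix.trace_mul_comm, ht, Matrix.trace_mul_comm]

theorem Strategy.IsOptimal.box_pos {m n : ℕ} {S : Strategy m n} (hS : S.IsOptimal)
    (a b x y : Fin 2) : 0 < S.box a b x y := by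
  rw [(equivUpToLocalIsometry_of_isOptimal hS).box_eq]
  exact box_qubitStrategy_pos a b x y

/-! ### Steering -/

namespace Strategy

variable {m n : ℕ} {S : Strategy m n}

theorem box_eq_expect_assemblageB (S : Strategy m n) (a b x y : Fin 2) :
    S.box a b x y = expect (S.assemblageB x a) (S.B y b) := by
  rw [expect_apply, assemblageB, Matrix.trace_mul_comm, ← traceA_one_kronecker_mul, trace_traceA,
    ← Matrix.mul_assoc, one_kronecker_mul_kronecker_one, Matrix.trace_mul_comm, box]

theorem box_eq_expect_assemblageA (S : Strategy m n) (a b x y : Fin 2) :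
    S.box a b x y = expect (S.assemblageA y b) (S.A x a) := by
  rw [expect_apply, assemblageA, Matrix.trace_mul_comm, ← traceB_kronecker_one_mul, trace_traceB,
    ← Matrix.mul_assoc, kronecker_one_mul_one_kronecker, Matrix.trace_mul_comm, box]

theorem IsQuantum.probA_eq_sum_box (h : S.IsQuantum) (a x y : Fin 2) :
    S.probA x a = ∑ b, S.box a b x y := by
  simp only [box_eq_expect_assemblageB]
  rw [← map_sum, (h.bob y).2, expect_apply, Matrix.mul_one, probA]

theorem IsQuantum.probB_eq_sum_box (h : S.IsQuantum) (b x y : Fin 2) :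
    S.probB y b = ∑ a, S.box a b x y := by
  simp only [box_eq_expect_assemblageA]
  rw [← map_sum, (h.alice x).2, expect_apply, Matrix.mul_one, probB]

theorem IsOptimal.probA_pos (h : S.IsOptimal) (x a : Fin 2) : 0 < S.probA x a := by
  rw [h.1.probA_eq_sum_box a x 0]
  exact Finset.sum_pos (fun b _ => h.box_pos a b x 0) Finset.univ_nonempty

theorem IsOptimal.probB_pos (h : S.IsOptimal) (y b : Fin 2) : 0 < S.probB y b := by
  rw [h.1.probB_eq_sum_box b 0 y]
  exact Finset.sum_pos (fun a _ => h.box_pos a b 0 y) Finset.univ_nonempty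

end Strategy

section Certainty

variable {ι : Type} [Fintype ι]

theorem isDensity_smul {τ : Matrix ι ι ℂ} (hτ : τ.PosSemidef) (ht : 0 < τ.trace.re) :
    IsDensity (((τ.trace.re)⁻¹ : ℂ) • τ) := by
  have h0 := Complex.le_def.1 hτ.trace_nonneg
  have h1 : τ.trace = (τ.trace.re : ℂ) := Complex.ext rfl h0.2.symm
  have h2 : (0 : ℂ) ≤ (τ.trace.re : ℂ)⁻¹ := by
    rw [← Complex.ofReal_inv]
    exact Complex.zero_le_real.2 (inv_nonneg.2 ht.le)
  refine ⟨hτ.smul h2, ?_⟩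
  rw [Matrix.trace_smul, smul_eq_mul]
  nth_rewrite 2 [h1]
  exact inv_mul_cancel₀ (Complex.ofReal_ne_zero.2 ht.ne')

theorem exists_isDensity_expect_eq_one {τ M : Matrix ι ι ℂ} (hτ : τ.PosSemidef)
    (ht : 0 < τ.trace.re) (hM : M * τ = τ) : ∃ σ, IsDensity σ ∧ expect σ M = 1 := by
  have hσ := isDensity_smul hτ ht
  refine ⟨_, hσ, ?_⟩
  rw [expect_apply, Matrix.trace_mul_comm, Matrix.mul_smul, hM, hσ.2, Complex.one_re]

theorem expect_add_expect_eq_one [DecidableEq ι] {σ : Matrix ι ι ℂ} (hσ : IsDensity σ)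
    {M : Fin 2 → Matrix ι ι ℂ} (hM : IsPOVM M) {b b' : Fin 2} (hb : b ≠ b') :
    expect σ (M b) + expect σ (M b') = 1 := by
  have h : M b + M b' = 1 := by
    have := hM.2
    rw [Fin.sum_univ_two] at this
    fin_cases b <;> fin_cases b' <;> simp_all
    rw [add_comm, this]
  rw [← map_add, h, expect_apply, Matrix.mul_one, hσ.2, Complex.one_re]

theorem mul_mul_eq_of_sq_mul_eq [DecidableEq ι] {M ρ : Matrix ι ι ℂ} (h : M * (M * ρ) = ρ)
    (b : Fin 2) :
    ((1 / 2 : ℂ) • (1 + (-1 : ℂ) ^ (b : ℕ) • M)) * (((1 / 2 : ℂ) • (1 + (-1 : ℂ) ^ (b : ℕ) • M)) * ρ)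
      = ((1 / 2 : ℂ) • (1 + (-1 : ℂ) ^ (b : ℕ) • M)) * ρ := by
  fin_cases b <;>
    simp only [add_mul, mul_add, smul_mul_assoc, mul_smul_comm, one_mul, h, pow_zero,
      pow_one] <;>
    module

end Certainty

namespace Strategy

variable {m n : ℕ} {S : Strategy m n}

/-- The measurement operator K acts idempotently on ρ, although it need not be a projection
elsewhere. Hence Bob's marginal of K ρ K† is fixed by the effect; its trace is positive because the
outcome has positive probability. -/
theorem IsOptimal.exists_certainB (h : S.IsOptimal) (y b : Fin 2) :
    ∃ σ, IsDensity σ ∧ expect σ (S.B y b) = 1 := by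
  have hρ := h.1.state.1
  have hrel := h.1.optimalRelations (isOptimal_iff.1 h).2
  have hsq : S.opB y * (S.opB y * S.ρ) = S.ρ := by
    fin_cases y
    · exact hrel.sqQ1
    · have := hrel.sqQ0
      rwa [neg_mul, neg_mul, mul_neg, neg_neg] at this
  set K := (1 : Matrix (Fin m) (Fin m) ℂ) ⊗ₖ S.B y b with hK
  have hKeq : K = (1 / 2 : ℂ) • (1 + (-1 : ℂ) ^ (b : ℕ) • S.opB y) := by
    rw [hK, (h.1.bob y).eq_obs b, Matrix.kronecker_smul, Matrix.kronecker_add,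
      Matrix.kronecker_smul, Matrix.one_kronecker_one, opB]
  have hKK : K * (K * S.ρ) = K * S.ρ := by
    rw [hKeq]
    exact mul_mul_eq_of_sq_mul_eq hsq b
  have hKs : K.conjTranspose = K := by
    rw [hK, Matrix.conjTranspose_kronecker, Matrix.conjTranspose_one,
      ((h.1.bob y).1 b).isHermitian.eq]
  refine exists_isDensity_expect_eq_one
    (posSemidef_traceA (hρ.mul_mul_conjTranspose_same K)) ?_ ?_
  · have hp := h.probB_pos y b
    rw [probB, assemblageA, trace_traceB, ← hKK, Matrix.trace_mul_comm, ← trace_traceA] at hp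
    rwa [hKs]
  · rw [← traceA_one_kronecker_mul, ← Matrix.mul_assoc, hKK]

theorem IsOptimal.exists_certainA (h : S.IsOptimal) (x a : Fin 2) :
    ∃ σ, IsDensity σ ∧ expect σ (S.A x a) = 1 := by
  have hρ := h.1.state.1
  have hrel := h.1.optimalRelations (isOptimal_iff.1 h).2
  have hsq : S.opA x * (S.opA x * S.ρ) = S.ρ := by
    fin_cases x
    · exact hrel.sqP0
    · exact hrel.sqP1
  set K := S.A x a ⊗ₖ (1 : Matrix (Fin n) (Fin n) ℂ) with hK
  have hKeq : K = (1 / 2 : ℂ) • (1 + (-1 : ℂ) ^ (a : ℕ) • S.opA x) := by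
    rw [hK, (h.1.alice x).eq_obs a, Matrix.smul_kronecker, Matrix.add_kronecker,
      Matrix.smul_kronecker, Matrix.one_kronecker_one, opA]
  have hKK : K * (K * S.ρ) = K * S.ρ := by
    rw [hKeq]
    exact mul_mul_eq_of_sq_mul_eq hsq a
  have hKs : K.conjTranspose = K := by
    rw [hK, Matrix.conjTranspose_kronecker, Matrix.conjTranspose_one,
      ((h.1.alice x).1 a).isHermitian.eq]
  refine exists_isDensity_expect_eq_one
    (posSemidef_traceB (hρ.mul_mul_conjTranspose_same K)) ?_ ?_
  · have hp := h.probA_pos x a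
    rw [probA, assemblageB, trace_traceA, ← hKK, Matrix.trace_mul_comm, ← trace_traceB] at hp
    rwa [hKs]
  · rw [← traceB_kronecker_one_mul, ← Matrix.mul_assoc, hKK]

/-- If exactly one pair of input and answer of Bob wins against Alice's pair `(x,a)`, then in an
optimal strategy the uncertainty relation is trivial but Alice does not steer to certainty. -/
theorem IsOptimal.isTrivialB_and_not_aliceSteersTo (h : S.IsOptimal) {x a y₀ b₀ : Fin 2}
    (hV : ∀ y b, V a b x y = if y = y₀ ∧ b = b₀ then 1 else 0) :
    S.IsTrivialB x a ∧ 0 < S.probA x a ∧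
      ∀ σ, S.IsMaxCertainB x a σ → ¬ S.AliceSteersTo x a σ := by
  have hw : ∀ y σ, S.winProbB x a y σ = if y = y₀ then expect σ (S.B y₀ b₀) else 0 := by
    intro y σ
    simp only [winProbB, hV]
    split_ifs with hy
    · subst hy; simp [expect_apply]
    · simp [hy]
  have hu : ∀ σ, S.uncertaintyB x a σ = 1 / 2 * expect σ (S.B y₀ b₀) := by
    intro σ
    simp only [uncertaintyB, hw]
    simp
  obtain ⟨σ₀, hσ₀, hc⟩ := h.exists_certainB y₀ b₀
  refine ⟨⟨σ₀, hσ₀, fun y ⟨b, hb⟩ => ?_⟩, h.probA_pos x a, ?_⟩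
  · rw [hV] at hb
    have hy : y = y₀ := by
      by_contra hy
      simp [hy] at hb
    rw [hw, if_pos hy, hc]
  -- Comparison with σ₀ forces the winning answer to have probability at least one in σ, while a
  -- positive joint probability for the other answer b' forces less than one.
  · rintro σ ⟨hσ, hmax⟩ ⟨hp, hs⟩
    obtain ⟨b', hb'⟩ := exists_ne b₀
    have h1 := hmax σ₀ hσ₀
    rw [hu, hu, hc] at h1
    have h2 := expect_add_expect_eq_one hσ (h.1.bob y₀) hb'
    have h3 := h.box_pos a b' x y₀
    rw [box_eq_expect_assemblageB, hs, expect_apply, Matrix.smul_mul, Matrix.trace_smul, smul_eq_mul,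
      Complex.re_ofReal_mul, ← expect_apply] at h3
    linarith [(mul_pos_iff_of_pos_left hp).1 h3]

/-- If exactly one pair of input and answer of Alice wins against Bob's pair `(y,b)`, then in an
optimal strategy the uncertainty relation is trivial but Bob does not steer to certainty. -/
theorem IsOptimal.isTrivialA_and_not_bobSteersTo (h : S.IsOptimal) {y b x₀ a₀ : Fin 2}
    (hV : ∀ x a, V a b x y = if x = x₀ ∧ a = a₀ then 1 else 0) :
    S.IsTrivialA y b ∧ 0 < S.probB y b ∧
      ∀ σ, S.IsMaxCertainA y b σ → ¬ S.BobSteersTo y b σ := by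
  have hw : ∀ x σ, S.winProbA y b x σ = if x = x₀ then expect σ (S.A x₀ a₀) else 0 := by
    intro x σ
    simp only [winProbA, hV]
    split_ifs with hx
    · subst hx; simp [expect_apply]
    · simp [hx]
  have hu : ∀ σ, S.uncertaintyA y b σ = 1 / 2 * expect σ (S.A x₀ a₀) := by
    intro σ
    simp only [uncertaintyA, hw]
    simp
  obtain ⟨σ₀, hσ₀, hc⟩ := h.exists_certainA x₀ a₀
  refine ⟨⟨σ₀, hσ₀, fun x ⟨a, ha⟩ => ?_⟩, h.probB_pos y b, ?_⟩
  · rw [hV] at ha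
    have hx : x = x₀ := by
      by_contra hx
      simp [hx] at ha
    rw [hw, if_pos hx, hc]
  · rintro σ ⟨hσ, hmax⟩ ⟨hp, hs⟩
    obtain ⟨a', ha'⟩ := exists_ne a₀
    have h1 := hmax σ₀ hσ₀
    rw [hu, hu, hc] at h1
    have h2 := expect_add_expect_eq_one hσ (h.1.alice x₀) ha'
    have h3 := h.box_pos a' b x₀ y
    rw [box_eq_expect_assemblageA, hs, expect_apply, Matrix.smul_mul, Matrix.trace_smul, smul_eq_mul,
      Complex.re_ofReal_mul, ← expect_apply] at h3
    linarith [(mul_pos_iff_of_pos_left hp).1 h3]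

end Strategy

/-! ### Nontrivial uncertainty relations of the qubit strategy -/

theorem observable_mul_of_expect_projector {θ : ℝ} {σ : Matrix (Fin 2) (Fin 2) ℂ}
    (hσ : IsDensity σ) {a : Fin 2} (h : expect σ (projector θ a) = 1) :
    observable θ * σ = (-1 : ℂ) ^ (a : ℕ) • σ := by
  obtain ⟨b, hb⟩ := exists_ne a
  have h1 := expect_add_expect_eq_one hσ (isPOVM_projector θ) hb
  have h2 := mul_eq_zero_of_posSemidef hσ.1 ((isPOVM_projector θ).1 b) (by linarith)
  have h3 : (-1 : ℂ) ^ (b : ℕ) = -(-1) ^ (a : ℕ) := by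
    fin_cases a <;> fin_cases b <;> simp_all
  rw [projector, h3, Matrix.smul_mul, Matrix.add_mul, Matrix.one_mul, Matrix.smul_mul] at h2
  have h4 : σ = (-1 : ℂ) ^ (a : ℕ) • (observable θ * σ) := by
    have := (smul_eq_zero.1 h2).resolve_left (by norm_num)
    rw [neg_smul, ← sub_eq_add_neg] at this
    exact sub_eq_zero.1 this
  nth_rewrite 2 [h4]
  rw [smul_smul, ← pow_add, ← two_mul, pow_mul, neg_one_sq, one_pow, one_smul]

/-- A common eigenvector with opposite eigenvalues would need `phase` = -1, so all columns of σ
vanish. -/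
theorem not_isDensity_of_observable_mul {σ : Matrix (Fin 2) (Fin 2) ℂ} {s : ℂ} (hs : s ≠ 0)
    (h0 : observable 0 * σ = s • σ) (h1 : observable (alpha 1) * σ = -s • σ) : ¬ IsDensity σ := by
  intro hσ
  have hph : phase + 1 ≠ 0 := fun h => phase_im_pos.ne' (by simpa using congrArg Complex.im h)
  rw [observable_zero] at h0
  rw [observable_alpha_one] at h1
  have key : ∀ j, σ 1 j = 0 ∧ σ 0 j = 0 := by
    intro j
    have e0 := congrFun (congrFun h0 0) j
    have e1 := congrFun (congrFun h1 0) j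
    simp [Matrix.mul_apply] at e0 e1
    have hz : (phase + 1) * σ 1 j = 0 := by linear_combination e1 + e0
    have hz' := (mul_eq_zero.1 hz).resolve_left hph
    refine ⟨hz', ?_⟩
    rw [hz'] at e0
    exact (mul_eq_zero.1 e0.symm).resolve_left hs
  have ht := hσ.2
  rw [Matrix.trace_fin_two, (key 0).2, (key 1).1, add_zero] at ht
  exact zero_ne_one ht

theorem not_isTrivialB_qubitStrategy (ψ : Fin 2 × Fin 2 → ℂ) :
    ¬ (qubitStrategy ψ).IsTrivialB 1 0 := by
  rintro ⟨σ, hσ, h⟩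
  have h0 := h 0 ⟨1, by simp [V]⟩
  have h1 := h 1 ⟨1, by simp [V]⟩
  simp [Strategy.winProbB, V, qubitStrategy, ← expect_apply] at h0 h1
  have k0 := observable_mul_of_expect_projector hσ h0
  have k1 := observable_mul_of_expect_projector hσ h1
  rw [observable_beta_one] at k1
  refine not_isDensity_of_observable_mul (s := -1) (by norm_num) ?_ ?_ hσ
  · simpa [beta_zero] using k0
  · simpa using k1

theorem not_isTrivialA_qubitStrategy (ψ : Fin 2 × Fin 2 → ℂ) :
    ¬ (qubitStrategy ψ).IsTrivialA 0 0 := by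
  rintro ⟨σ, hσ, h⟩
  have h0 := h 0 ⟨0, by simp [V]⟩
  have h1 := h 1 ⟨1, by simp [V]⟩
  simp [Strategy.winProbA, V, qubitStrategy, ← expect_apply] at h0 h1
  have k0 := observable_mul_of_expect_projector hσ h0
  have k1 := observable_mul_of_expect_projector hσ h1
  refine not_isDensity_of_observable_mul (s := 1) (by norm_num) ?_ ?_ hσ
  · simpa [alpha_zero] using k0
  · simpa using k1

/-! ### The values of the game -/

/-- The value is affine in each of four probabilities; the bound is certified by products of the
nonnegativity constraints, after eliminating the probabilities of answer 1. -/
theorem gameValue_product_le {p q : Fin 2 → Fin 2 → ℝ} (hp : ∀ x, p x ∈ stdSimplex ℝ (Fin 2))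
    (hq : ∀ y, q y ∈ stdSimplex ℝ (Fin 2)) :
    gameValue (fun a b x y => p x a * q y b) ≤ 1 / 2 := by
  have hp1 : ∀ x, p x 1 = 1 - p x 0 := fun x => by
    have := (hp x).2
    rw [Fin.sum_univ_two] at this
    linarith
  have hq1 : ∀ y, q y 1 = 1 - q y 0 := fun y => by
    have := (hq y).2
    rw [Fin.sum_univ_two] at this
    linarith
  have p0 := fun x => (hp x).1 0
  have p1 := fun x => (hp x).1 1
  have q0 := fun y => (hq y).1 0
  have q1 := fun y => (hq y).1 1
  have e : gameValue (fun a b x y => p x a * q y b) = 1 / 4 * (p 0 0 * q 0 0 +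
      (p 1 0 * q 0 1 + p 1 1 * q 0 0) + p 0 1 * q 1 0 + p 1 0 * q 1 1) := by
    simp [gameValue, V, Fin.sum_univ_two]
    ring
  rw [e]
  simp only [hp1, hq1] at p1 q1 ⊢
  nlinarith [mul_nonneg (p0 0) (q0 1), mul_nonneg (p0 0) (q1 0), mul_nonneg (p1 0) (q1 1),
    mul_nonneg (p1 0) (q1 0), mul_nonneg (p1 0) (q0 0), mul_nonneg (p1 1) (q1 1),
    mul_nonneg (p1 1) (q0 0), mul_nonneg (p0 1) (q0 1), mul_nonneg (p0 1) (q0 0),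
    mul_nonneg (p1 1) (q1 0), p1 1, q1 0, q1 1, p1 0]

theorem isGreatest_classical : IsGreatest (gameValue '' {P | IsClassicalBox P}) (1 / 2) := by
  constructor
  -- Always answering a = 0 and b = 1 wins exactly when x = 1.
  · refine ⟨fun a b _ _ => (if a = 0 then 1 else 0) * (if b = 1 then 1 else 0), ?_, ?_⟩
    · refine ⟨1, fun _ => 1, fun _ _ a => if a = 0 then 1 else 0,
        fun _ _ b => if b = 1 then 1 else 0, ?_, ?_, ?_, ?_⟩
      · simp [stdSimplex]
      · exact fun _ _ => ⟨fun a => by dsimp only; split_ifs <;> norm_num, by simp⟩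
      · exact fun _ _ => ⟨fun a => by dsimp only; split_ifs <;> norm_num, by simp⟩
      · simp
    · simp [gameValue, V, Fin.sum_univ_two]
      norm_num
  · rintro _ ⟨P, ⟨N, p, PA, PB, hp, hA, hB, hP⟩, rfl⟩
    have h : gameValue P = ∑ l, p l * gameValue (fun a b x y => PA l x a * PB l y b) := by
      simp only [gameValue, hP, Fin.sum_univ_two, Finset.mul_sum, ← Finset.sum_add_distrib]
      exact Finset.sum_congr rfl fun l _ => by ring
    rw [h]
    calc ∑ l, p l * gameValue (fun a b x y => PA l x a * PB l y b)
        ≤ ∑ l, p l * (1 / 2) := Finset.sum_le_sum fun l _ =>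
          mul_le_mul_of_nonneg_left (gameValue_product_le (hA l) (hB l)) (hp.1 l)
      _ = 1 / 2 := by rw [← Finset.sum_mul, hp.2, one_mul]

theorem isGreatest_quantum : IsGreatest (gameValue '' {P | IsQuantumBox P}) omegaQ := by
  constructor
  · exact ⟨_, ⟨2, 2, qubitStrategy topState, isQuantum_qubitStrategy star_topState_dotProduct, rfl⟩,
      value_qubitStrategy_topState⟩
  · rintro _ ⟨_, ⟨m, n, S, hS, rfl⟩, rfl⟩
    exact hS.value_le

end NonlocalGame

end

/-! ### The proposition -/

open NonlocalGame in
theorem proposition1 :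
    -- classical value
    IsGreatest (gameValue '' {P | IsClassicalBox P}) (1 / 2) ∧
    -- quantum value
    IsGreatest (gameValue '' {P | IsQuantumBox P}) omegaQ ∧
    |omegaQ - 0.545| < 0.0005 ∧
    -- the explicit optimal qubit strategy, its uniqueness, and its nontrivial uncertainty relations
    (∃ ψ : Fin 2 × Fin 2 → ℂ,
      IsTopEigenvector ψ ∧
      (∀ φ, IsTopEigenvector φ → ∃ c : ℂ, ‖c‖ = 1 ∧ φ = c • ψ) ∧
      (qubitStrategy ψ).IsOptimal ∧
      (qubitStrategy ψ).value = omegaQ ∧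
      (∀ (m n : ℕ) (S : Strategy m n), S.IsOptimal →
        S.EquivUpToLocalIsometry (qubitStrategy ψ)) ∧
      ¬ (qubitStrategy ψ).IsTrivialB 1 0 ∧
      ¬ (qubitStrategy ψ).IsTrivialA 0 0) ∧
    -- failure of steering, for all optimal quantum strategies
    (∀ (m n : ℕ) (S : Strategy m n), S.IsOptimal →
      (∀ x a : Fin 2, (x, a) ∈ ({(0, 0), (0, 1), (1, 1)} : Set (Fin 2 × Fin 2)) →
        S.IsTrivialB x a ∧ 0 < S.probA x a ∧
        ∀ σ, S.IsMaxCertainB x a σ → ¬ S.AliceSteersTo x a σ) ∧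
      (∀ y b : Fin 2, (y, b) ∈ ({(0, 1), (1, 0), (1, 1)} : Set (Fin 2 × Fin 2)) →
        S.IsTrivialA y b ∧ 0 < S.probB y b ∧
        ∀ σ, S.IsMaxCertainA y b σ → ¬ S.BobSteersTo y b σ) ∧
      ¬ S.CorrespondenceAliceSteersBob ∧
      ¬ S.CorrespondenceBobSteersAlice) := by
  refine ⟨isGreatest_classical, isGreatest_quantum, ?_, ⟨topState, isTopEigenvector_topState,
    fun φ => eq_smul_of_isTopEigenvector, isOptimal_iff.2
      ⟨isQuantum_qubitStrategy star_topState_dotProduct, value_qubitStrategy_topState⟩,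
    value_qubitStrategy_topState, fun m n S => equivUpToLocalIsometry_of_isOptimal,
    not_isTrivialB_qubitStrategy _, not_isTrivialA_qubitStrategy _⟩, fun m n S hS => ?_⟩
  · have h1 := sqrt_thirteen_gt
    have h2 := sqrt_thirteen_lt
    rw [omegaQ, abs_lt]
    constructor <;> linarith
  · have hA : ∀ x a : Fin 2, (x, a) ∈ ({(0, 0), (0, 1), (1, 1)} : Set (Fin 2 × Fin 2)) →
        S.IsTrivialB x a ∧ 0 < S.probA x a ∧
        ∀ σ, S.IsMaxCertainB x a σ → ¬ S.AliceSteersTo x a σ := by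
      intro x a hxa
      simp only [Set.mem_insert_iff, Set.mem_singleton_iff, Prod.mk.injEq] at hxa
      obtain ⟨rfl, rfl⟩ | ⟨rfl, rfl⟩ | ⟨rfl, rfl⟩ := hxa
      · exact hS.isTrivialB_and_not_aliceSteersTo (y₀ := 0) (b₀ := 0) (by simp [V])
      · exact hS.isTrivialB_and_not_aliceSteersTo (y₀ := 1) (b₀ := 0) (by simp [V])
      · exact hS.isTrivialB_and_not_aliceSteersTo (y₀ := 0) (b₀ := 0) (by simp [V])
    have hB : ∀ y b : Fin 2, (y, b) ∈ ({(0, 1), (1, 0), (1, 1)} : Set (Fin 2 × Fin 2)) →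
        S.IsTrivialA y b ∧ 0 < S.probB y b ∧
        ∀ σ, S.IsMaxCertainA y b σ → ¬ S.BobSteersTo y b σ := by
      intro y b hyb
      simp only [Set.mem_insert_iff, Set.mem_singleton_iff, Prod.mk.injEq] at hyb
      obtain ⟨rfl, rfl⟩ | ⟨rfl, rfl⟩ | ⟨rfl, rfl⟩ := hyb
      · exact hS.isTrivialA_and_not_bobSteersTo (x₀ := 1) (a₀ := 0) (by simp [V])
      · exact hS.isTrivialA_and_not_bobSteersTo (x₀ := 0) (a₀ := 1) (by simp [V])
      · exact hS.isTrivialA_and_not_bobSteersTo (x₀ := 1) (a₀ := 0) (by simp [V])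
    refine ⟨hA, hB, fun h => ?_, fun h => ?_⟩
    -- A single pair that occurs without steering to maximal certainty refutes the correspondence.
    · obtain ⟨-, hp, hn⟩ := hA 0 0 (by simp)
      obtain ⟨σ, hσ, hs⟩ := h 0 0 hp
      exact hn σ hσ hs
    · obtain ⟨-, hp, hn⟩ := hB 0 1 (by simp)
      obtain ⟨σ, hσ, hs⟩ := h 0 1 hp
      exact hn σ hσ hs
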